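/- Let $S^1=\mathbb R/2\pi\mathbb Z$. For a regular closed plane curve $\gamma:S^1\to\mathbb R^2$ write $ds=|\gamma_x|\,dx$, $\partial_s=|\gamma_x|^{-1}\partial_x$, $\tau=\partial_s\gamma$, $\nu=\mathrm R\tau$ with $\mathrm R$ the counterclockwise rotation by $\pi/2$, and let $\kappa$ be the curvature, defined by $\partial_s\tau=\kappa\nu$. For $\varepsilon>0$, we say that $\gamma$ evolves by the gradient of the functional $$\mathcal G^\varepsilon(\gamma)=\int_\gamma(1+\varepsilon\kappa^2)\,ds$$ if $\gamma:S^1\times[0,+\infty)\to\mathbb R^2$ is a smooth map (up to $t=0$) such that $\gamma(\cdot,t)$ is an immersion for every $t\ge 0$ and $$\partial_t\gamma=-\left(-\kappa+2\varepsilon\,\partial_s^2\kappa+\varepsilon\kappa^3\right)\nu .$$ Theorem. For every $j\in\mathbb N=\{0,1,2,\dots\}$ there exists a smooth function $Z^j:\mathbb R\to(0,+\infty)$, depending only on $j$, such that for every $\varepsilon\in(0,1)$, every $\gamma$ evolving by the gradient of $\mathcal G^\varepsilon$, and every $t\ge0$, the function $t\mapsto\int_\gamma|\partial_s^j\kappa|^2\,ds$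 is differentiable at $t$ (from the right if $t=0$) and $$\partial_t\int_\gamma|\partial_s^j\kappa|^2\,ds\;\le\; Z^j\!\left(\int_\gamma\kappa^2\,ds\right).$$ -/

import Mathlib

open scoped ContDiff

/-- The Euclidean plane. -/
abbrev Plane : Type := EuclideanSpace ℝ (Fin 2)

namespace PlaneCurve

noncomputable section

/-- The counterclockwise rotation by `π / 2` in the plane. -/
def rot (v : Plane) : Plane := !₂[-(v 1), v 0]

/-- The arclength derivative `∂ₛ f = |cₓ|⁻¹ ∂ₓ f` of a function `f` along the parametrized
curve `c`. -/
def arcDeriv {F : Type*} [NormedAddCommGroup F] [NormedSpace ℝ F]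
    (c : ℝ → Plane) (f : ℝ → F) : ℝ → F :=
  fun x => ‖deriv c x‖⁻¹ • deriv f x

/-- The unit tangent `τ = ∂ₛ c`. -/
def tangent (c : ℝ → Plane) : ℝ → Plane := arcDeriv c c

/-- The unit normal `ν = R τ`. -/
def normal (c : ℝ → Plane) : ℝ → Plane := fun x => rot (tangent c x)

/-- The signed curvature, given by `∂ₛ τ = κ ν`, that is, `κ = ⟨∂ₛ τ, ν⟩`. -/
def curvature (c : ℝ → Plane) : ℝ → ℝ :=
  fun x => inner ℝ (arcDeriv c (tangent c) x) (normal c x)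

/-- The `j`-th arclength derivative `∂ₛʲ κ` of the curvature. -/
def curvatureDeriv (c : ℝ → Plane) (j : ℕ) : ℝ → ℝ :=
  (fun f => arcDeriv c f)^[j] (curvature c)

/-- The integral `∫ f ds` over the closed curve parametrized by the `2π`-periodic map `c`,
with `ds = |cₓ| dx`. -/
def arcIntegral (c : ℝ → Plane) (f : ℝ → ℝ) : ℝ :=
  ∫ x in (0 : ℝ)..(2 * Real.pi), f x * ‖deriv c x‖

/-- The normal `L²(ds)`-gradient `-κ + 2 ε ∂ₛ² κ + ε κ³` of the functional
`∫ (1 + ε κ²) ds`. -/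
def energyGradient (ε : ℝ) (c : ℝ → Plane) : ℝ → ℝ :=
  fun x => -curvature c x + 2 * ε * curvatureDeriv c 2 x + ε * curvature c x ^ 3

/-- `γ t x` is a family of closed curves evolving by the gradient of `∫ (1 + ε κ²) ds`: a smooth
map `S¹ × [0, ∞) → ℝ²` that is an immersion at every time and solves `∂ₜ γ = -E ν` with
`E = -κ + 2 ε ∂ₛ² κ + ε κ³`.  Maps on `S¹ = ℝ / 2πℤ` are given as `2π`-periodic maps on `ℝ`.
Only the values of `γ` at times `t ≥ 0` matter; at `t = 0` smoothness and the time derivative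
are one-sided. -/
structure IsGradientFlow (ε : ℝ) (γ : ℝ → ℝ → Plane) : Prop where
  smooth : ContDiffOn ℝ ∞ (fun p : ℝ × ℝ => γ p.1 p.2) (Set.Ici 0 ×ˢ Set.univ)
  periodic : ∀ t, 0 ≤ t → Function.Periodic (γ t) (2 * Real.pi)
  immersion : ∀ t, 0 ≤ t → ∀ x, deriv (γ t) x ≠ 0
  evolution : ∀ t, 0 ≤ t → ∀ x,
    derivWithin (fun s => γ s x) (Set.Ici 0) t = -(energyGradient ε (γ t) x) • normal (γ t) x

end

end PlaneCurve

/-!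
The flow has normal velocity `F = κ - 2 ε ∂ₛ² κ - ε κ³`, so that `∂ₜ ds = -κ F ds`,
`∂ₜ κ = ∂ₛ² F + κ² F` and `∂ₜ ∂ₛ = ∂ₛ ∂ₜ + κ F ∂ₛ`.  By induction on `j`
(`exists_timeDeriv_curv`),
`∂ₜ ∂ₛʲ κ = ∂ₛʲ⁺² κ - 2 ε ∂ₛʲ⁺⁴ κ + P + ε Q`
with polynomials `P`, `Q` in `κ, ∂ₛ κ, ∂ₛ² κ, …`, all of whose monomials have at least three
factors and at most `j`, respectively `j + 2`, derivatives in total.  Integrating by parts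
(`exists_hasDerivWithinAt_energy`),
`∂ₜ ∫ |∂ₛʲ κ|² ds = -2 ∫ |∂ₛʲ⁺¹ κ|² ds - 4 ε ∫ |∂ₛʲ⁺² κ|² ds + ∫ ∂ₛʲ κ P' ds + ε ∫ ∂ₛʲ κ Q' ds`
with `P'`, `Q'` of the same type as `P`, `Q`.

The last two integrals are subcritical and are absorbed by the two negative ones
(`IsDiffPoly.exists_integral_mul_le`), with `m = j + 1` derivatives for `P'` and `m = j + 2` for
`Q'`.  Here integration by parts makes the norms `‖∂ₛᵃ κ‖` in `L²` a log-convex sequence in `a`,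
and the one-dimensional Sobolev inequality bounds the supremum of `|∂ₛᵃ κ|²` by
`‖∂ₛᵃ κ‖² / L + 2 ‖∂ₛᵃ κ‖ ‖∂ₛᵃ⁺¹ κ‖`.  The length `L` is bounded from below by `1 / ∫ κ² ds`, since
the unit tangent of a closed curve has mean zero (`one_le_length_mul_integral_sq`).  To avoid
fractional exponents all bounds are expressed through `r` with `r ^ (2 * m) = 1 + ‖∂ₛᵐ κ‖`: a
monomial `∏ ∂ₛᵃⁱ κ` of weight `d = ∑ (2 aᵢ + 1)` is at most a constant times `r ^ d` in the
supremum norm, and `r ^ (d - 1)` in `L²`, where the constant is a power of a bound on `∫ κ² ds`.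

Derivatives on `[0, ∞) × ℝ` are taken within this set, so that the computation holds at `t = 0` with
one-sided derivatives; second derivatives commute there as well (`timeDeriv_spaceDeriv`).
-/

namespace PlaneCurve

noncomputable section

/-! ### Interpolation for periodic functions of arclength -/

/-- The setting of one-dimensional interpolation on a closed curve: `v` is the speed of a
parametrization by `[0, T]` of a closed curve, and `u a` is the `a`-th arclength derivative of
`u 0`.  Periodicity enters only through the equality of the values at `0` and `T`. -/
structure IsPeriodicJet (T : ℝ) (v : ℝ → ℝ) (u : ℕ → ℝ → ℝ) : Prop where
  pos : 0 < T
  cont : Continuous v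
  speed_pos : ∀ x, 0 < v x
  hasDerivAt : ∀ a x, HasDerivAt (u a) (u (a + 1) x * v x) x
  endpoints : ∀ a, u a T = u a 0

theorem integral_mul_sq_le {T : ℝ} (hT : 0 < T) {v f g : ℝ → ℝ} (hv : Continuous v)
    (hv0 : ∀ x, 0 < v x) (hf : Continuous f) (hg : Continuous g) :
    (∫ x in (0 : ℝ)..T, f x * g x * v x) ^ 2 ≤
      (∫ x in (0 : ℝ)..T, f x ^ 2 * v x) * ∫ x in (0 : ℝ)..T, g x ^ 2 * v x := by
  have key : ∀ l : ℝ, 0 ≤ (∫ x in (0 : ℝ)..T, g x ^ 2 * v x) * (l * l) +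
      (2 * ∫ x in (0 : ℝ)..T, f x * g x * v x) * l + ∫ x in (0 : ℝ)..T, f x ^ 2 * v x := by
    intro l
    have h : ∫ x in (0 : ℝ)..T, (l * g x + f x) ^ 2 * v x =
        (∫ x in (0 : ℝ)..T, g x ^ 2 * v x) * (l * l) +
        (2 * ∫ x in (0 : ℝ)..T, f x * g x * v x) * l + ∫ x in (0 : ℝ)..T, f x ^ 2 * v x := by
      rw [mul_comm _ (l * l), ← intervalIntegral.integral_const_mul,
        ← intervalIntegral.integral_const_mul, ← intervalIntegral.integral_mul_const,
        ← intervalIntegral.integral_add, ← intervalIntegral.integral_add]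
      · congr 1; ext x; ring
      all_goals apply Continuous.intervalIntegrable; fun_prop
    rw [← h]
    exact intervalIntegral.integral_nonneg hT.le
      fun x _ => mul_nonneg (sq_nonneg _) (hv0 x).le
  have := discrim_le_zero key
  unfold discrim at this
  nlinarith

theorem integral_abs_mul_le {T : ℝ} (hT : 0 < T) {v f g : ℝ → ℝ} (hv : Continuous v)
    (hv0 : ∀ x, 0 < v x) (hf : Continuous f) (hg : Continuous g) :
    ∫ x in (0 : ℝ)..T, |f x * g x| * v x ≤
      √(∫ x in (0 : ℝ)..T, f x ^ 2 * v x) * √(∫ x in (0 : ℝ)..T, g x ^ 2 * v x) := by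
  have h := integral_mul_sq_le hT hv hv0 hf.abs hg.abs
  simp only [sq_abs, ← abs_mul] at h
  rw [← Real.sqrt_mul
    (intervalIntegral.integral_nonneg hT.le fun x _ => mul_nonneg (sq_nonneg _) (hv0 x).le)]
  exact Real.le_sqrt_of_sq_le h

/-- A nonnegative log-convex sequence on `{0, …, m}` is bounded by `1` as soon as its two
end values are. -/
theorem le_one_of_logConvex {m : ℕ} {c : ℕ → ℝ} (hc : ∀ a, 0 ≤ c a) (h0 : c 0 ≤ 1)
    (hm : c m ≤ 1) (hconv : ∀ a, a + 1 < m → c (a + 1) ^ 2 ≤ c a * c (a + 2)) :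
    ∀ a ≤ m, c a ≤ 1 := by
  obtain ⟨i, hi, hmax⟩ := (Finset.range (m + 1)).exists_max_image c ⟨0, by simp⟩
  have hex : ∃ n, n ≤ m ∧ c n = c i := ⟨i, by simpa [Nat.lt_succ_iff] using hi, rfl⟩
  classical
  -- the least index at which the maximum is attained
  obtain ⟨hnm, hn⟩ := Nat.find_spec hex
  have hmin : ∀ k < Nat.find hex, k ≤ m → c k < c i := fun k hk hkm =>
    lt_of_le_of_ne (hmax k (by simp; omega)) fun h => Nat.find_min hex hk ⟨hkm, h⟩
  generalize Nat.find hex = n at hnm hn hmin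
  suffices c n ≤ 1 from fun a ha => (hmax a (by simp; omega)).trans (hn ▸ this)
  rcases n with _ | k
  · exact h0
  rcases hnm.eq_or_lt with h | h
  · exact h ▸ hm
  have h1 := hconv k h
  have h2 := hmin k (by omega) (by omega)
  have h3 := hmax (k + 2) (by simp; omega)
  rw [hn] at h1 ⊢
  nlinarith [hc k, hc (k + 2)]

namespace IsPeriodicJet

variable {T : ℝ} {v : ℝ → ℝ} {u : ℕ → ℝ → ℝ}

theorem continuous (h : IsPeriodicJet T v u) (a : ℕ) : Continuous (u a) :=
  continuous_iff_continuousAt.2 fun x => (h.hasDerivAt a x).continuousAt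

theorem integral_sq_nonneg (h : IsPeriodicJet T v u) (a : ℕ) :
    0 ≤ ∫ x in (0 : ℝ)..T, u a x ^ 2 * v x :=
  intervalIntegral.integral_nonneg h.pos.le
    fun x _ => mul_nonneg (sq_nonneg _) (h.speed_pos x).le

theorem integral_mul_deriv (h : IsPeriodicJet T v u) (a b : ℕ) :
    ∫ x in (0 : ℝ)..T, u a x * u (b + 1) x * v x =
      -∫ x in (0 : ℝ)..T, u (a + 1) x * u b x * v x := by
  have hc := h.cont
  have ha := h.continuous a
  have ha1 := h.continuous (a + 1)
  have hb := h.continuous b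
  have hb1 := h.continuous (b + 1)
  have key : ∫ x in (0 : ℝ)..T, (u (a + 1) x * v x * u b x + u a x * (u (b + 1) x * v x)) =
      u a T * u b T - u a 0 * u b 0 := by
    apply intervalIntegral.integral_eq_sub_of_hasDerivAt
    · exact fun x _ => (h.hasDerivAt a x).mul (h.hasDerivAt b x)
    · apply Continuous.intervalIntegrable; fun_prop
  rw [h.endpoints a, h.endpoints b, sub_self, intervalIntegral.integral_add] at key
  · rw [eq_neg_iff_add_eq_zero, add_comm]
    convert key using 3 <;> ext x <;> ring
  all_goals apply Continuous.intervalIntegrable; fun_prop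

/-- The `L²` norms of consecutive derivatives form a log-convex sequence. -/
theorem norm_sq_le (h : IsPeriodicJet T v u) (a : ℕ) :
    √(∫ x in (0 : ℝ)..T, u (a + 1) x ^ 2 * v x) ^ 2 ≤
      √(∫ x in (0 : ℝ)..T, u a x ^ 2 * v x) * √(∫ x in (0 : ℝ)..T, u (a + 2) x ^ 2 * v x) := by
  rw [Real.sq_sqrt (h.integral_sq_nonneg _), ← Real.sqrt_mul (h.integral_sq_nonneg _)]
  apply Real.le_sqrt_of_sq_le
  have h1 := integral_mul_sq_le h.pos h.cont h.speed_pos (h.continuous a) (h.continuous (a + 2))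
  rw [h.integral_mul_deriv a (a + 1), neg_sq] at h1
  simpa only [sq] using h1

/-- The pointwise Agmon inequality `u² ≤ ‖u‖² / L + 2 ‖u‖ ‖u'‖`, with the length `L` multiplied
out. -/
theorem length_mul_sq_le (h : IsPeriodicJet T v u) (a : ℕ) {x : ℝ} (hx : x ∈ Set.Icc 0 T) :
    (∫ y in (0 : ℝ)..T, v y) * u a x ^ 2 ≤ (∫ y in (0 : ℝ)..T, u a y ^ 2 * v y) +
      (∫ y in (0 : ℝ)..T, v y) * (2 * (√(∫ y in (0 : ℝ)..T, u a y ^ 2 * v y) *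
        √(∫ y in (0 : ℝ)..T, u (a + 1) y ^ 2 * v y))) := by
  have hc := h.cont
  have ha := h.continuous a
  have ha1 := h.continuous (a + 1)
  have key : ∀ y ∈ Set.Icc 0 T, u a x ^ 2 ≤ u a y ^ 2 +
      2 * (√(∫ y in (0 : ℝ)..T, u a y ^ 2 * v y) *
        √(∫ y in (0 : ℝ)..T, u (a + 1) y ^ 2 * v y)) := by
    intro y hy
    have h1 : ∫ z in y..x, 2 * u a z * (u (a + 1) z * v z) = u a x ^ 2 - u a y ^ 2 := by
      apply intervalIntegral.integral_eq_sub_of_hasDerivAt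
      · intro z _
        simpa using (h.hasDerivAt a z).fun_pow 2
      · apply Continuous.intervalIntegrable; fun_prop
    have h2 : |∫ z in y..x, 2 * u a z * (u (a + 1) z * v z)| ≤
        |(∫ z in y..x, |2 * u a z * (u (a + 1) z * v z)|)| := by
      simpa using intervalIntegral.norm_integral_le_abs_integral_norm
        (f := fun z => 2 * u a z * (u (a + 1) z * v z)) (a := y) (b := x)
        (μ := MeasureTheory.volume)
    have h3 : |(∫ z in y..x, |2 * u a z * (u (a + 1) z * v z)|)| ≤
        |(∫ z in (0 : ℝ)..T, |2 * u a z * (u (a + 1) z * v z)|)| := by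
      apply intervalIntegral.abs_integral_mono_interval
      · rw [Set.uIoc_of_le h.pos.le]
        exact Set.Ioc_subset_Ioc (le_min hy.1 hx.1) (max_le hy.2 hx.2)
      · exact Filter.Eventually.of_forall fun z => abs_nonneg _
      · apply Continuous.intervalIntegrable; fun_prop
    have h4 : ∫ z in (0 : ℝ)..T, |2 * u a z * (u (a + 1) z * v z)| =
        2 * ∫ z in (0 : ℝ)..T, |u a z * u (a + 1) z| * v z := by
      rw [← intervalIntegral.integral_const_mul]
      congr 1; ext z
      rw [abs_mul, abs_mul, abs_mul, abs_mul, abs_of_pos (h.speed_pos z), abs_two]; ring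
    have h5 := integral_abs_mul_le h.pos hc h.speed_pos ha ha1
    rw [h4, abs_of_nonneg (a := 2 * _) (mul_nonneg zero_le_two
      (intervalIntegral.integral_nonneg h.pos.le
        fun z _ => mul_nonneg (abs_nonneg _) (h.speed_pos z).le))] at h3
    rw [h1] at h2
    linarith [le_abs_self (u a x ^ 2 - u a y ^ 2)]
  have h6 := intervalIntegral.integral_mono_on (μ := MeasureTheory.volume)
    (f := fun y => u a x ^ 2 * v y)
    (g := fun y => u a y ^ 2 * v y + 2 * (√(∫ y in (0 : ℝ)..T, u a y ^ 2 * v y) *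
        √(∫ y in (0 : ℝ)..T, u (a + 1) y ^ 2 * v y)) * v y) h.pos.le
    (by apply Continuous.intervalIntegrable; fun_prop)
    (by apply Continuous.intervalIntegrable; fun_prop)
    (fun y hy => by
      rw [← add_mul]
      exact mul_le_mul_of_nonneg_right (key y hy) (h.speed_pos y).le)
  rw [intervalIntegral.integral_add (by apply Continuous.intervalIntegrable; fun_prop)
    (by apply Continuous.intervalIntegrable; fun_prop), intervalIntegral.integral_const_mul,
    intervalIntegral.integral_const_mul] at h6
  linarith

end IsPeriodicJet

/-- Scale-invariant bounds on a jet up to order `m`: each derivative counts for `r ^ 2`, each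
factor measured in the supremum norm for `r`, and `b` is a bound depending on the `L²` norm of
`u 0` only. -/
structure ScaledBounds (T : ℝ) (v : ℝ → ℝ) (u : ℕ → ℝ → ℝ) (m : ℕ) (b r : ℝ) : Prop where
  two_le : 2 ≤ b
  one_le : 1 ≤ r
  sup_le : ∀ a < m, ∀ x ∈ Set.Icc 0 T, |u a x| ≤ b ^ 3 * r ^ (2 * a + 1)
  integral_le : ∀ a ≤ m, ∫ x in (0 : ℝ)..T, u a x ^ 2 * v x ≤ b ^ 2 * r ^ (4 * a)

/-- Interpolation: choosing `r` with `r ^ (2 * m) = 1 + ‖u m‖` gives the scale-invariant bounds.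
The hypothesis `hL` bounds the length from below in terms of the `L²` norm of `u 0`. -/
theorem IsPeriodicJet.exists_scaledBounds {T : ℝ} {v : ℝ → ℝ} {u : ℕ → ℝ → ℝ}
    (h : IsPeriodicJet T v u)
    (hL : 1 ≤ (∫ x in (0 : ℝ)..T, v x) * ∫ x in (0 : ℝ)..T, u 0 x ^ 2 * v x)
    {m : ℕ} (hm : m ≠ 0) {b : ℝ} (hb : 2 + (∫ x in (0 : ℝ)..T, u 0 x ^ 2 * v x) ≤ b) :
    ∃ r : ℝ, r ^ (4 * m) ≤ 2 + 2 * (∫ x in (0 : ℝ)..T, u m x ^ 2 * v x) ∧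
      ScaledBounds T v u m b r := by
  set N : ℕ → ℝ := fun a => √(∫ x in (0 : ℝ)..T, u a x ^ 2 * v x) with hN
  have hN0 : ∀ a, 0 ≤ N a := fun a => Real.sqrt_nonneg _
  have hNsq : ∀ a, ∫ x in (0 : ℝ)..T, u a x ^ 2 * v x = N a ^ 2 := fun a =>
    (Real.sq_sqrt (h.integral_sq_nonneg a)).symm
  have hlog : ∀ a, N (a + 1) ^ 2 ≤ N a * N (a + 2) := h.norm_sq_le
  have hsup := fun a x (hx : x ∈ Set.Icc 0 T) => h.length_mul_sq_le a hx
  simp only [hNsq] at hL hb hsup ⊢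
  simp only [Real.sqrt_sq (hN0 _)] at hsup
  set L := ∫ x in (0 : ℝ)..T, v x
  have hLpos : 0 < L := by
    by_contra hneg
    nlinarith [sq_nonneg (N 0), mul_nonneg (sub_nonneg.2 (not_lt.1 hneg)) (sq_nonneg (N 0))]
  have hb2 : 2 ≤ b := by nlinarith [sq_nonneg (N 0)]
  have hb0 : 0 < b := by linarith
  have hbN : N 0 ≤ b := by nlinarith [sq_nonneg (N 0 - 1)]
  have h1m : 1 ≤ 1 + N m := by linarith [hN0 m]
  set r : ℝ := (1 + N m) ^ ((2 * m : ℕ) : ℝ)⁻¹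
  have hr1 : 1 ≤ r := Real.one_le_rpow h1m (by positivity)
  have hr0 : 0 < r := by linarith
  have hr : r ^ (2 * m) = 1 + N m := Real.rpow_inv_natCast_pow (by linarith) (by positivity)
  have hNa : ∀ a ≤ m, N a ≤ b * r ^ (2 * a) := by
    have := le_one_of_logConvex (m := m) (c := fun a => N a / (b * r ^ (2 * a)))
      (fun a => div_nonneg (hN0 a) (by positivity)) (by simpa using div_le_one_of_le₀ hbN hb0.le)
      (by
        rw [hr]
        refine div_le_one_of_le₀ ?_ (by positivity)
        nlinarith [hN0 m])
      (fun a _ => by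
        rw [div_pow, div_mul_div_comm, div_le_div_iff₀ (by positivity) (by positivity)]
        have : b * r ^ (2 * a) * (b * r ^ (2 * (a + 2))) = (b * r ^ (2 * (a + 1))) ^ 2 := by ring
        rw [this]
        exact mul_le_mul_of_nonneg_right (hlog a) (by positivity))
    intro a ha
    exact (div_le_one (by positivity)).1 (this a ha)
  refine ⟨r, ?_, hb2, hr1, ?_, ?_⟩
  · have : r ^ (4 * m) = (r ^ (2 * m)) ^ 2 := by ring
    rw [this, hr]
    nlinarith [sq_nonneg (N m - 1)]
  · intro a ha x hx
    have h1 : u a x ^ 2 ≤ N a ^ 2 * N 0 ^ 2 + 2 * (N a * N (a + 1)) := by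
      refine le_of_mul_le_mul_left ?_ hLpos
      have := mul_le_mul_of_nonneg_left hL (sq_nonneg (N a))
      nlinarith [hsup a x hx]
    have h2 := hNa a ha.le
    have h3 := hNa (a + 1) ha
    have h4 : N a ^ 2 * N 0 ^ 2 ≤ (b * r ^ (2 * a)) ^ 2 * b := by
      have : N 0 ^ 2 ≤ b := by linarith
      have := hN0 a
      gcongr
    have h5 : N a * N (a + 1) ≤ (b * r ^ (2 * a)) * (b * r ^ (2 * (a + 1))) := by
      have := hN0 (a + 1)
      gcongr
    have h6 : (b * r ^ (2 * a)) ^ 2 * b = b ^ 3 * r ^ (4 * a) := by ring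
    have h7 : (b * r ^ (2 * a)) * (b * r ^ (2 * (a + 1))) = b ^ 2 * r ^ (4 * a + 2) := by ring
    have h8 : r ^ (4 * a) ≤ r ^ (4 * a + 2) := pow_le_pow_right₀ hr1 (by omega)
    have h9 : b ^ 3 * r ^ (4 * a) ≤ b ^ 3 * r ^ (4 * a + 2) := by gcongr
    have h10 : (b ^ 3 + 2 * b ^ 2) * r ^ (4 * a + 2) ≤ b ^ 6 * r ^ (4 * a + 2) := by
      gcongr
      have e1 : b ^ 2 * 8 ≤ b ^ 2 * b ^ 3 := by
        gcongr
        calc (8 : ℝ) = 2 ^ 3 := by norm_num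
          _ ≤ b ^ 3 := by gcongr
      have e2 : b ^ 3 * 2 ≤ b ^ 3 * b ^ 2 := by
        gcongr
        nlinarith
      have e3 : b ^ 5 * 2 ≤ b ^ 5 * b := by gcongr
      nlinarith [sq_nonneg b]
    refine abs_le_of_sq_le_sq' ?_ (by positivity) |> abs_le.2
    calc u a x ^ 2 ≤ b ^ 6 * r ^ (4 * a + 2) := by nlinarith
      _ = (b ^ 3 * r ^ (2 * a + 1)) ^ 2 := by ring
  · intro a ha
    rw [hNsq]
    calc N a ^ 2 ≤ (b * r ^ (2 * a)) ^ 2 := by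
          have := hN0 a
          have := hNa a ha
          gcongr
      _ = b ^ 2 * r ^ (4 * a) := by ring

/-! ### Differential polynomials -/

/-- `IsDiffPoly S d p`: the functional `p` on jets is a linear combination of products
`u a₁ ⋯ u aₙ` with `n ≥ 1`, of total order `∑ aᵢ ≤ S` and of weight `∑ (2 aᵢ + 1) ≤ d`. -/
inductive IsDiffPoly : ℕ → ℕ → ((ℕ → ℝ) → ℝ) → Prop
  | var (a : ℕ) : IsDiffPoly a (2 * a + 1) fun u => u a
  | mul {S d S' d' : ℕ} {p q : (ℕ → ℝ) → ℝ} (hp : IsDiffPoly S d p) (hq : IsDiffPoly S' d' q) :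
      IsDiffPoly (S + S') (d + d') fun u => p u * q u
  | add {S d : ℕ} {p q : (ℕ → ℝ) → ℝ} (hp : IsDiffPoly S d p) (hq : IsDiffPoly S d q) :
      IsDiffPoly S d fun u => p u + q u
  | smul {S d : ℕ} (c : ℝ) {p : (ℕ → ℝ) → ℝ} (hp : IsDiffPoly S d p) :
      IsDiffPoly S d fun u => c * p u
  | mono {S d S' d' : ℕ} {p : (ℕ → ℝ) → ℝ} (hp : IsDiffPoly S d p) (hS : S ≤ S')
      (hd : d ≤ d') : IsDiffPoly S' d' p

namespace IsDiffPoly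

variable {S d : ℕ} {p : (ℕ → ℝ) → ℝ}

theorem continuous (hp : IsDiffPoly S d p) {u : ℕ → ℝ → ℝ} (hu : ∀ a, Continuous (u a)) :
    Continuous fun x => p fun a => u a x := by
  induction hp with
  | var a => exact hu a
  | mul _ _ h1 h2 => exact h1.mul h2
  | add _ _ h1 h2 => exact h1.add h2
  | smul c _ h => exact h.const_mul c
  | mono _ _ _ h => exact h

/-- The formal arclength derivative of a differential polynomial. -/
theorem exists_deriv (hp : IsDiffPoly S d p) :
    ∃ q, IsDiffPoly (S + 1) (d + 2) q ∧ ∀ (v : ℝ → ℝ) (u : ℕ → ℝ → ℝ) (x : ℝ),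
      (∀ a, HasDerivAt (u a) (u (a + 1) x * v x) x) →
      HasDerivAt (fun y => p fun a => u a y) ((q fun a => u a x) * v x) x := by
  induction hp with
  | var a => exact ⟨fun u => u (a + 1), var (a + 1), fun v u x h => h a⟩
  | @mul S d S' d' p q hp hq h1 h2 =>
    obtain ⟨p', hp', h1⟩ := h1
    obtain ⟨q', hq', h2⟩ := h2
    refine ⟨fun u => p' u * q u + p u * q' u,
      ((hp'.mul hq).mono (by omega) (by omega)).add ((hp.mul hq').mono (by omega) (by omega)),
      fun v u x h => ?_⟩
    exact ((h1 v u x h).mul (h2 v u x h)).congr_deriv (by ring)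
  | add hp hq h1 h2 =>
    obtain ⟨p', hp', h1⟩ := h1
    obtain ⟨q', hq', h2⟩ := h2
    refine ⟨fun u => p' u + q' u, hp'.add hq', fun v u x h => ?_⟩
    exact ((h1 v u x h).add (h2 v u x h)).congr_deriv (by ring)
  | smul c hp h1 =>
    obtain ⟨p', hp', h1⟩ := h1
    refine ⟨fun u => c * p' u, hp'.smul c, fun v u x h => ?_⟩
    exact ((h1 v u x h).const_mul c).congr_deriv (by ring)
  | mono hp hS hd h1 =>
    obtain ⟨p', hp', h1⟩ := h1
    exact ⟨p', hp'.mono (by omega) (by omega), h1⟩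

theorem exists_sup_le (hp : IsDiffPoly S d p) :
    ∃ K : ℕ, ∀ (T : ℝ) (v : ℝ → ℝ) (u : ℕ → ℝ → ℝ) (m : ℕ) (b r : ℝ),
      ScaledBounds T v u m b r → S < m → ∀ x ∈ Set.Icc 0 T,
        |p fun a => u a x| ≤ b ^ K * r ^ d := by
  induction hp with
  | var a => exact ⟨3, fun T v u m b r h ha x hx => h.sup_le a ha x hx⟩
  | mul hp hq h1 h2 =>
    obtain ⟨K, h1⟩ := h1
    obtain ⟨K', h2⟩ := h2
    refine ⟨K + K', fun T v u m b r h hm x hx => ?_⟩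
    have hb := h.two_le
    have hr := h.one_le
    rw [abs_mul]
    calc _ ≤ (b ^ K * r ^ _) * (b ^ K' * r ^ _) :=
          mul_le_mul (h1 T v u m b r h (by omega) x hx) (h2 T v u m b r h (by omega) x hx)
            (abs_nonneg _) (by positivity)
      _ = _ := by ring
  | @add S d p q hp hq h1 h2 =>
    obtain ⟨K, h1⟩ := h1
    obtain ⟨K', h2⟩ := h2
    refine ⟨max K K' + 1, fun T v u m b r h hm x hx => ?_⟩
    have hb := h.two_le
    have hr := h.one_le
    have e1 : b ^ K * r ^ d ≤ b ^ max K K' * r ^ d := by gcongr; linarith; exact le_max_left _ _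
    have e2 : b ^ K' * r ^ d ≤ b ^ max K K' * r ^ d := by gcongr; linarith; exact le_max_right _ _
    have e3 : b ^ max K K' * r ^ d * 2 ≤ b ^ max K K' * r ^ d * b := by gcongr
    calc _ ≤ _ := abs_add_le _ _
      _ ≤ b ^ max K K' * r ^ d * b := by
        linarith [h1 T v u m b r h hm x hx, h2 T v u m b r h hm x hx]
      _ = _ := by ring
  | @smul S d c p hp h1 =>
    obtain ⟨K, h1⟩ := h1
    obtain ⟨n, hn⟩ := pow_unbounded_of_one_lt |c| one_lt_two
    refine ⟨n + K, fun T v u m b r h hm x hx => ?_⟩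
    have hb := h.two_le
    have hr := h.one_le
    rw [abs_mul]
    calc _ ≤ b ^ n * (b ^ K * r ^ d) :=
          mul_le_mul (hn.le.trans (by gcongr)) (h1 T v u m b r h hm x hx)
            (abs_nonneg _) (by positivity)
      _ = _ := by ring
  | @mono S d S' d' p hp hS hd h1 =>
    obtain ⟨K, h1⟩ := h1
    refine ⟨K, fun T v u m b r h hm x hx => ?_⟩
    have hb := h.two_le
    have hr := h.one_le
    refine (h1 T v u m b r h (by omega) x hx).trans ?_
    gcongr

/-- `L²` bound on differential polynomials of order at most `m`: in each product all factors
but one have order less than `m`, and are estimated in the supremum norm.  The factor `r ^ 2` is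
gained by measuring the remaining factor in `L²`. -/
theorem exists_integral_sq_le (hp : IsDiffPoly S d p) :
    ∃ K : ℕ, ∀ (T : ℝ) (v : ℝ → ℝ) (u : ℕ → ℝ → ℝ) (m : ℕ) (b r : ℝ), IsPeriodicJet T v u →
      ScaledBounds T v u m b r → m ≠ 0 → S ≤ m →
        r ^ 2 * (∫ x in (0 : ℝ)..T, (p fun a => u a x) ^ 2 * v x) ≤ b ^ K * r ^ (2 * d) := by
  induction hp with
  | var a =>
    refine ⟨2, fun T v u m b r hj h hm ha => ?_⟩
    have hr := h.one_le
    calc _ ≤ r ^ 2 * (b ^ 2 * r ^ (4 * a)) := by gcongr; exact h.integral_le a ha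
      _ = _ := by ring
  | @mul S d S' d' p q hp hq h1 h2 =>
    obtain ⟨K, h1⟩ := h1
    obtain ⟨K', h2⟩ := h2
    obtain ⟨J, h3⟩ := hp.exists_sup_le
    obtain ⟨J', h4⟩ := hq.exists_sup_le
    refine ⟨2 * J + K' + (2 * J' + K), fun T v u m b r hj h hm hS => ?_⟩
    have hb := h.two_le
    have hr := h.one_le
    have hv := hj.cont
    have hpc := hp.continuous hj.continuous
    have hqc := hq.continuous hj.continuous
    -- the factor `f` is bounded by `M`, the factor `g` in `L²`
    have aux : ∀ (f g : ℝ → ℝ) (M W : ℝ), Continuous f → Continuous g → 0 ≤ M →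
        (∀ x ∈ Set.Icc 0 T, |f x| ≤ M) →
        r ^ 2 * (∫ x in (0 : ℝ)..T, g x ^ 2 * v x) ≤ W →
        r ^ 2 * (∫ x in (0 : ℝ)..T, (f x * g x) ^ 2 * v x) ≤ M ^ 2 * W := by
      intro f g M W hf hg hM hfM hgW
      have : ∫ x in (0 : ℝ)..T, (f x * g x) ^ 2 * v x ≤
          ∫ x in (0 : ℝ)..T, M ^ 2 * (g x ^ 2 * v x) := by
        apply intervalIntegral.integral_mono_on hj.pos.le
        · apply Continuous.intervalIntegrable; fun_prop
        · apply Continuous.intervalIntegrable; fun_prop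
        · intro x hx
          rw [mul_pow, mul_assoc]
          have := hj.speed_pos x
          gcongr ?_ * _
          exact sq_le_sq' (abs_le.1 (hfM x hx)).1 (abs_le.1 (hfM x hx)).2
      rw [intervalIntegral.integral_const_mul] at this
      calc _ ≤ r ^ 2 * (M ^ 2 * ∫ x in (0 : ℝ)..T, g x ^ 2 * v x) := by gcongr
        _ = M ^ 2 * (r ^ 2 * ∫ x in (0 : ℝ)..T, g x ^ 2 * v x) := by ring
        _ ≤ _ := by gcongr
    rcases Nat.lt_or_ge S m with hlt | hge
    · refine (aux _ _ _ _ hpc hqc (by positivity) (h3 T v u m b r h hlt)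
        (h2 T v u m b r hj h hm (by omega))).trans ?_
      calc _ = b ^ (2 * J + K') * r ^ (2 * (d + d')) := by ring
        _ ≤ _ := mul_le_mul_of_nonneg_right
          (pow_le_pow_right₀ (by linarith) (by omega)) (by positivity)
    · have := aux _ _ _ _ hqc hpc (by positivity) (h4 T v u m b r h (by omega))
        (h1 T v u m b r hj h hm (by omega))
      simp only [mul_comm (q _)] at this
      refine this.trans ?_
      calc _ = b ^ (2 * J' + K) * r ^ (2 * (d + d')) := by ring
        _ ≤ _ := mul_le_mul_of_nonneg_right
          (pow_le_pow_right₀ (by linarith) (by omega)) (by positivity)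
  | @add S d p q hp hq h1 h2 =>
    obtain ⟨K, h1⟩ := h1
    obtain ⟨K', h2⟩ := h2
    refine ⟨max K K' + 2, fun T v u m b r hj h hm hS => ?_⟩
    have hb := h.two_le
    have hr := h.one_le
    have hv := hj.cont
    have hpc := hp.continuous hj.continuous
    have hqc := hq.continuous hj.continuous
    have e1 : b ^ K * r ^ (2 * d) ≤ b ^ max K K' * r ^ (2 * d) := by
      gcongr; linarith; exact le_max_left _ _
    have e2 : b ^ K' * r ^ (2 * d) ≤ b ^ max K K' * r ^ (2 * d) := by
      gcongr; linarith; exact le_max_right _ _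
    have e3 : b ^ max K K' * r ^ (2 * d) * 2 ^ 2 ≤ b ^ max K K' * r ^ (2 * d) * b ^ 2 := by gcongr
    have e4 : ∫ x in (0 : ℝ)..T, ((p fun a => u a x) + q fun a => u a x) ^ 2 * v x ≤
        ∫ x in (0 : ℝ)..T,
          2 * ((p fun a => u a x) ^ 2 * v x) + 2 * ((q fun a => u a x) ^ 2 * v x) := by
      apply intervalIntegral.integral_mono_on hj.pos.le
      · exact (((hpc.add hqc).pow 2).mul hv).intervalIntegrable _ _
      · exact ((((hpc.pow 2).mul hv).const_mul 2).add
          (((hqc.pow 2).mul hv).const_mul 2)).intervalIntegrable _ _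
      · intro x _
        nlinarith [hj.speed_pos x, mul_nonneg
          (sq_nonneg ((p fun a => u a x) - q fun a => u a x)) (hj.speed_pos x).le]
    have ip : Continuous fun x => 2 * ((p fun a => u a x) ^ 2 * v x) :=
      ((hpc.pow 2).mul hv).const_mul 2
    have iq : Continuous fun x => 2 * ((q fun a => u a x) ^ 2 * v x) :=
      ((hqc.pow 2).mul hv).const_mul 2
    rw [intervalIntegral.integral_add (ip.intervalIntegrable _ _) (iq.intervalIntegrable _ _),
      intervalIntegral.integral_const_mul, intervalIntegral.integral_const_mul] at e4
    have e5 := mul_le_mul_of_nonneg_left e4 (sq_nonneg r)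
    calc _ ≤ b ^ max K K' * r ^ (2 * d) * b ^ 2 := by
          linarith [h1 T v u m b r hj h hm hS, h2 T v u m b r hj h hm hS]
      _ = _ := by ring
  | @smul S d c p hp h1 =>
    obtain ⟨K, h1⟩ := h1
    obtain ⟨n, hn⟩ := pow_unbounded_of_one_lt (c ^ 2) one_lt_two
    refine ⟨n + K, fun T v u m b r hj h hm hS => ?_⟩
    have hb := h.two_le
    have hr := h.one_le
    simp only [mul_pow, mul_assoc (c ^ 2)]
    rw [intervalIntegral.integral_const_mul]
    have hi : 0 ≤ ∫ x in (0 : ℝ)..T, (p fun a => u a x) ^ 2 * v x :=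
      intervalIntegral.integral_nonneg hj.pos.le
        fun x _ => mul_nonneg (sq_nonneg _) (hj.speed_pos x).le
    calc _ = c ^ 2 * (r ^ 2 * ∫ x in (0 : ℝ)..T, (p fun a => u a x) ^ 2 * v x) := by ring
      _ ≤ b ^ n * (b ^ K * r ^ (2 * d)) :=
          mul_le_mul (hn.le.trans (by gcongr)) (h1 T v u m b r hj h hm hS)
            (by positivity) (by positivity)
      _ = _ := by ring
  | @mono S d S' d' p hp hS hd h1 =>
    obtain ⟨K, h1⟩ := h1
    refine ⟨K, fun T v u m b r hj h hm hS => ?_⟩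
    have hb := h.two_le
    have hr := h.one_le
    refine (h1 T v u m b r hj h hm (by omega)).trans ?_
    gcongr

end IsDiffPoly

/-- Absorption by Young's inequality: a lower power of `r` is dominated by half of a higher
one, up to a constant. -/
theorem mul_pow_le_absorb {k n : ℕ} (hk : k < n) {A r : ℝ} (hA : 1 ≤ A) (hr : 1 ≤ r) :
    A * r ^ k ≤ r ^ n / 2 + 2 ^ n * A ^ (n + 1) := by
  rcases le_total r (2 * A) with h | h
  · have h1 : A * r ^ k ≤ 2 ^ n * A ^ (n + 1) :=
      calc A * r ^ k ≤ A * r ^ n := by gcongr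
        _ ≤ A * (2 * A) ^ n := by gcongr
        _ = _ := by ring
    linarith [show 0 ≤ r ^ n / 2 by positivity]
  · have h1 : 2 * (A * r ^ k) ≤ r ^ n :=
      calc 2 * (A * r ^ k) = (2 * A) * r ^ k := by ring
        _ ≤ r * r ^ k := by gcongr
        _ = r ^ (k + 1) := by ring
        _ ≤ r ^ n := pow_le_pow_right₀ hr hk
    linarith [show 0 ≤ 2 ^ n * A ^ (n + 1) by positivity]

/-- The product of `u j` with a differential polynomial is dominated by the square of the `L²`
norm of `u m`, up to a power of a bound on the `L²` norm of `u 0`.  The weight condition `hd` says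
that the product is subcritical: interpolation bounds it by `r ^ (4 * m - 1)`, whereas the square
of the norm of `u m` is comparable to `r ^ (4 * m)`. -/
theorem IsDiffPoly.exists_integral_mul_le {S d : ℕ} {p : (ℕ → ℝ) → ℝ} (hp : IsDiffPoly S d p)
    {j m : ℕ} (hj : j ≤ m) (hm : m ≠ 0) (hS : S ≤ m) (hd : 2 * j + d ≤ 4 * m) :
    ∃ K : ℕ, ∀ (T : ℝ) (v : ℝ → ℝ) (u : ℕ → ℝ → ℝ) (b : ℝ), IsPeriodicJet T v u →
      1 ≤ (∫ x in (0 : ℝ)..T, v x) * (∫ x in (0 : ℝ)..T, u 0 x ^ 2 * v x) →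
      2 + (∫ x in (0 : ℝ)..T, u 0 x ^ 2 * v x) ≤ b →
      ∫ x in (0 : ℝ)..T, u j x * (p fun a => u a x) * v x ≤
        (∫ x in (0 : ℝ)..T, u m x ^ 2 * v x) + b ^ K := by
  obtain ⟨K, hK⟩ := hp.exists_integral_sq_le
  refine ⟨4 * m + (2 + K) * (4 * m + 1) + 1, fun T v u b hu hL hb => ?_⟩
  obtain ⟨r, hr, h⟩ := hu.exists_scaledBounds hL hm hb
  have hb2 := h.two_le
  have hr1 := h.one_le
  have h1 := hK T v u m b r hu h hm hS
  have h2 := h.integral_le j hj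
  have h3 := integral_mul_sq_le hu.pos hu.cont hu.speed_pos (hu.continuous j)
    (hp.continuous hu.continuous)
  set I := ∫ x in (0 : ℝ)..T, u j x * (p fun a => u a x) * v x
  set B := ∫ x in (0 : ℝ)..T, (p fun a => u a x) ^ 2 * v x
  have hB : 0 ≤ B := intervalIntegral.integral_nonneg hu.pos.le
    fun x _ => mul_nonneg (sq_nonneg _) (hu.speed_pos x).le
  have h4 : (r * I) ^ 2 ≤ (b ^ (2 + K) * r ^ (2 * j + d)) ^ 2 :=
    calc (r * I) ^ 2 = r ^ 2 * I ^ 2 := by ring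
      _ ≤ r ^ 2 * ((∫ x in (0 : ℝ)..T, u j x ^ 2 * v x) * B) := by gcongr
      _ = (∫ x in (0 : ℝ)..T, u j x ^ 2 * v x) * (r ^ 2 * B) := by ring
      _ ≤ (b ^ 2 * r ^ (4 * j)) * (b ^ K * r ^ (2 * d)) := by gcongr
      _ = b ^ (2 + K) * r ^ (4 * j + 2 * d) := by ring
      _ ≤ b ^ (2 * (2 + K)) * r ^ (4 * j + 2 * d) := by gcongr; linarith; omega
      _ = _ := by ring
  have h5 : r * I ≤ b ^ (2 + K) * r ^ (2 * j + d) :=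
    (abs_le_of_sq_le_sq' h4 (by positivity)).2
  have h6 : I ≤ b ^ (2 + K) * r ^ (4 * m - 1) := by
    refine le_of_mul_le_mul_left (h5.trans ?_) (show 0 < r by linarith)
    calc b ^ (2 + K) * r ^ (2 * j + d) ≤ b ^ (2 + K) * r ^ (4 * m - 1 + 1) :=
          mul_le_mul_of_nonneg_left (pow_le_pow_right₀ hr1 (by omega)) (by positivity)
      _ = _ := by ring
  have h7 := mul_pow_le_absorb (k := 4 * m - 1) (n := 4 * m) (by omega)
    (one_le_pow₀ (n := 2 + K) (show 1 ≤ b by linarith)) hr1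
  have h8 : (2 : ℝ) ^ (4 * m) * (b ^ (2 + K)) ^ (4 * m + 1) ≤
      b ^ (4 * m + (2 + K) * (4 * m + 1)) :=
    calc _ ≤ b ^ (4 * m) * (b ^ (2 + K)) ^ (4 * m + 1) := by gcongr
      _ = _ := by ring
  have h9 : 1 ≤ b ^ (4 * m + (2 + K) * (4 * m + 1)) := one_le_pow₀ (by linarith)
  have h10 : b ^ (4 * m + (2 + K) * (4 * m + 1)) * 2 ≤
      b ^ (4 * m + (2 + K) * (4 * m + 1) + 1) := by
    rw [pow_succ]; gcongr
  linarith

/-! ### Calculus on the half-plane of nonnegative times -/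

/-- The space-time domain `[0, ∞) × ℝ`. -/
abbrev spaceTime : Set (ℝ × ℝ) := Set.Ici 0 ×ˢ Set.univ

/-- The time derivative on `[0, ∞) × ℝ`, one-sided at time `0`. -/
def timeDeriv (f : ℝ × ℝ → ℝ) (p : ℝ × ℝ) : ℝ :=
  fderivWithin ℝ f spaceTime p (1, 0)

/-- The space derivative on `[0, ∞) × ℝ`. -/
def spaceDeriv (f : ℝ × ℝ → ℝ) (p : ℝ × ℝ) : ℝ :=
  fderivWithin ℝ f spaceTime p (0, 1)

theorem uniqueDiffOn_spaceTime : UniqueDiffOn ℝ spaceTime :=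
  (uniqueDiffOn_Ici 0).prod uniqueDiffOn_univ

theorem contDiffOn_timeDeriv {f : ℝ × ℝ → ℝ} (hf : ContDiffOn ℝ ∞ f spaceTime) :
    ContDiffOn ℝ ∞ (timeDeriv f) spaceTime :=
  (hf.fderivWithin uniqueDiffOn_spaceTime (m := ∞) (by simp)).clm_apply contDiffOn_const

theorem contDiffOn_spaceDeriv {f : ℝ × ℝ → ℝ} (hf : ContDiffOn ℝ ∞ f spaceTime) :
    ContDiffOn ℝ ∞ (spaceDeriv f) spaceTime :=
  (hf.fderivWithin uniqueDiffOn_spaceTime (m := ∞) (by simp)).clm_apply contDiffOn_const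

theorem hasFDerivWithinAt_spaceTime {f : ℝ × ℝ → ℝ} (hf : ContDiffOn ℝ ∞ f spaceTime) {t : ℝ}
    (ht : 0 ≤ t) (x : ℝ) :
    HasFDerivWithinAt f (fderivWithin ℝ f spaceTime (t, x)) spaceTime (t, x) :=
  (hf.differentiableOn (by simp) (t, x) ⟨ht, trivial⟩).hasFDerivWithinAt

theorem hasDerivAt_space {f : ℝ × ℝ → ℝ} (hf : ContDiffOn ℝ ∞ f spaceTime) {t : ℝ}
    (ht : 0 ≤ t) (x : ℝ) : HasDerivAt (fun y => f (t, y)) (spaceDeriv f (t, x)) x := by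
  have h := (hasFDerivWithinAt_spaceTime hf ht x).comp_hasDerivWithinAt (s := Set.univ) x
    (((hasDerivAt_const x t).prodMk (hasDerivAt_id x)).hasDerivWithinAt)
    (fun y _ => ⟨ht, trivial⟩)
  exact hasDerivWithinAt_univ.1 h

theorem hasDerivWithinAt_time {f : ℝ × ℝ → ℝ} (hf : ContDiffOn ℝ ∞ f spaceTime) {t : ℝ}
    (ht : 0 ≤ t) (x : ℝ) :
    HasDerivWithinAt (fun s => f (s, x)) (timeDeriv f (t, x)) (Set.Ici 0) t :=
  (hasFDerivWithinAt_spaceTime hf ht x).comp_hasDerivWithinAt (s := Set.Ici 0) t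
    (((hasDerivAt_id t).prodMk (hasDerivAt_const t x)).hasDerivWithinAt)
    (fun s hs => show ((s, x) : ℝ × ℝ) ∈ spaceTime from ⟨hs, trivial⟩)

theorem timeDeriv_eq {f : ℝ × ℝ → ℝ} (hf : ContDiffOn ℝ ∞ f spaceTime) {t : ℝ}
    (ht : 0 ≤ t) {x f' : ℝ} (h : HasDerivWithinAt (fun s => f (s, x)) f' (Set.Ici 0) t) :
    timeDeriv f (t, x) = f' :=
  (uniqueDiffOn_Ici 0 t ht).eq_deriv _ (hasDerivWithinAt_time hf ht x) h

theorem spaceDeriv_eq {f : ℝ × ℝ → ℝ} (hf : ContDiffOn ℝ ∞ f spaceTime) {t : ℝ}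
    (ht : 0 ≤ t) {x f' : ℝ} (h : HasDerivAt (fun y => f (t, y)) f' x) :
    spaceDeriv f (t, x) = f' :=
  (hasDerivAt_space hf ht x).unique h

/-- Symmetry of second derivatives, up to the boundary `t = 0`. -/
theorem timeDeriv_spaceDeriv {f : ℝ × ℝ → ℝ} (hf : ContDiffOn ℝ ∞ f spaceTime) {t : ℝ}
    (ht : 0 ≤ t) (x : ℝ) :
    timeDeriv (spaceDeriv f) (t, x) = spaceDeriv (timeDeriv f) (t, x) := by
  have hmem : ((t, x) : ℝ × ℝ) ∈ spaceTime := ⟨ht, trivial⟩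
  have hcl : ((t, x) : ℝ × ℝ) ∈ closure (interior spaceTime) := by
    rw [interior_prod_eq, interior_Ici, interior_univ, closure_prod_eq, closure_Ioi,
      closure_univ]
    exact hmem
  have hsymm : IsSymmSndFDerivWithinAt ℝ f spaceTime (t, x) :=
    (hf (t, x) hmem).isSymmSndFDerivWithinAt
      (by simpa using WithTop.coe_le_coe.2 (le_top : (2 : ℕ∞) ≤ ⊤)) uniqueDiffOn_spaceTime hcl hmem
  have hd : DifferentiableWithinAt ℝ (fderivWithin ℝ f spaceTime) spaceTime (t, x) :=
    (hf.fderivWithin uniqueDiffOn_spaceTime (m := ∞) (by simp)).differentiableOn (by simp) _ hmem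
  have key : ∀ v w : ℝ × ℝ, fderivWithin ℝ (fun q => fderivWithin ℝ f spaceTime q v) spaceTime
      (t, x) w = fderivWithin ℝ (fderivWithin ℝ f spaceTime) spaceTime (t, x) w v := by
    intro v w
    have := hd.hasFDerivWithinAt.clm_apply (hasFDerivWithinAt_const v (t, x) spaceTime)
    rw [this.fderivWithin (uniqueDiffOn_spaceTime _ hmem)]
    simp
  unfold timeDeriv spaceDeriv
  rw [key, key]
  exact hsymm _ _

theorem continuous_slice {f : ℝ × ℝ → ℝ} (hf : ContinuousOn f spaceTime) {t : ℝ}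
    (ht : 0 ≤ t) : Continuous fun x => f (t, x) :=
  hf.comp_continuous (by fun_prop) fun _ => ⟨ht, trivial⟩

/-- Differentiation under the integral sign, up to the boundary `t = 0`. -/
theorem hasDerivWithinAt_integral {f : ℝ × ℝ → ℝ} (hf : ContDiffOn ℝ ∞ f spaceTime) {t : ℝ}
    (ht : 0 ≤ t) {a b : ℝ} :
    HasDerivWithinAt (fun s => ∫ x in a..b, f (s, x)) (∫ x in a..b, timeDeriv f (t, x))
      (Set.Ici 0) t := by
  have hcont := (contDiffOn_timeDeriv hf).continuousOn
  have hcomp : IsCompact (Set.Icc 0 (t + 1) ×ˢ Set.uIcc a b) :=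
    isCompact_Icc.prod isCompact_uIcc
  obtain ⟨C, hC⟩ := hcomp.exists_bound_of_continuousOn
    (hcont.mono (Set.prod_mono Set.Icc_subset_Ici_self (Set.subset_univ _)))
  rw [hasDerivWithinAt_iff_tendsto_slope]
  have hev : ∀ᶠ s in nhdsWithin t (Set.Ici 0 \ {t}), s ∈ Set.Icc 0 (t + 1) := by
    filter_upwards [self_mem_nhdsWithin,
      mem_nhdsWithin_of_mem_nhds (Iio_mem_nhds (show t < t + 1 by linarith))] with s hs hs'
    exact ⟨hs.1, le_of_lt hs'⟩
  have hlim : Filter.Tendsto (fun s => ∫ x in a..b, slope (fun s => f (s, x)) t s)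
      (nhdsWithin t (Set.Ici 0 \ {t})) (nhds (∫ x in a..b, timeDeriv f (t, x))) := by
    apply intervalIntegral.tendsto_integral_filter_of_dominated_convergence (fun _ => C)
    · filter_upwards [hev] with s hs
      apply Continuous.aestronglyMeasurable
      simp only [slope_def_field]
      exact ((continuous_slice hf.continuousOn hs.1).sub
        (continuous_slice hf.continuousOn ht)).div_const _
    · filter_upwards [hev] with s hs
      refine Filter.Eventually.of_forall fun x hx => ?_
      have hb := Convex.norm_image_sub_le_of_norm_hasDerivWithin_le (𝕜 := ℝ)
        (f := fun s => f (s, x)) (f' := fun s => timeDeriv f (s, x)) (s := Set.Icc 0 (t + 1))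
        (C := C) (x := t) (y := s)
        (fun z hz => (hasDerivWithinAt_time hf hz.1 x).mono Set.Icc_subset_Ici_self)
        (fun z hz => hC (z, x) ⟨hz, Set.uIoc_subset_uIcc hx⟩) (convex_Icc _ _)
        ⟨ht, by linarith⟩ hs
      have hC0 : 0 ≤ C := (norm_nonneg _).trans
        (hC (t, x) ⟨⟨ht, by linarith⟩, Set.uIoc_subset_uIcc hx⟩)
      rw [slope_def_field, norm_div]
      exact div_le_of_le_mul₀ (norm_nonneg _) hC0 hb
    · exact intervalIntegrable_const
    · exact Filter.Eventually.of_forall fun x _ =>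
        hasDerivWithinAt_iff_tendsto_slope.1 (hasDerivWithinAt_time hf ht x)
  refine hlim.congr' ?_
  filter_upwards [hev] with s hs
  simp only [slope_def_field]
  rw [intervalIntegral.integral_div, intervalIntegral.integral_sub
    ((continuous_slice hf.continuousOn hs.1).intervalIntegrable _ _)
    ((continuous_slice hf.continuousOn ht).intervalIntegrable _ _)]

/-! ### A lower bound for the length of a closed curve -/

/-- The total curvature of a closed plane curve with unit tangent `(p, q)` and curvature `k` is at
least `1`, because the tangent has mean zero.  With the Cauchy-Schwarz inequality this bounds the
length from below in terms of the `L²` norm of the curvature. -/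
theorem one_le_length_mul_integral_sq {T : ℝ} (hT : 0 < T) {v k p q : ℝ → ℝ} (hv : Continuous v)
    (hv0 : ∀ x, 0 < v x) (hk : Continuous k)
    (hp : ∀ x, HasDerivAt p (-(k x * q x * v x)) x) (hq : ∀ x, HasDerivAt q (k x * p x * v x) x)
    (hpq : ∀ x, p x ^ 2 + q x ^ 2 = 1) (hp0 : ∫ x in (0 : ℝ)..T, p x * v x = 0)
    (hq0 : ∫ x in (0 : ℝ)..T, q x * v x = 0) :
    1 ≤ (∫ x in (0 : ℝ)..T, v x) * ∫ x in (0 : ℝ)..T, k x ^ 2 * v x := by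
  have hpc : Continuous p := continuous_iff_continuousAt.2 fun x => (hp x).continuousAt
  have hqc : Continuous q := continuous_iff_continuousAt.2 fun x => (hq x).continuousAt
  set A := ∫ x in (0 : ℝ)..T, |k x| * v x
  have hL : 0 < ∫ x in (0 : ℝ)..T, v x :=
    intervalIntegral.intervalIntegral_pos_of_pos (hv.intervalIntegrable _ _) hv0 hT
  have hA : 0 ≤ A := intervalIntegral.integral_nonneg hT.le
    fun x _ => mul_nonneg (abs_nonneg _) (hv0 x).le
  -- the component of the tangent in the direction of the initial tangent
  have hphi : ∀ x ∈ Set.Icc 0 T, 1 - A ≤ p 0 * p x + q 0 * q x := by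
    intro x hx
    have h1 : ∫ z in (0 : ℝ)..x, (p 0 * -(k z * q z * v z) + q 0 * (k z * p z * v z)) =
        (p 0 * p x + q 0 * q x) - (p 0 * p 0 + q 0 * q 0) := by
      apply intervalIntegral.integral_eq_sub_of_hasDerivAt
        (f := fun z => p 0 * p z + q 0 * q z)
      · exact fun z _ => ((hp z).const_mul _).add ((hq z).const_mul _)
      · apply Continuous.intervalIntegrable; fun_prop
    have h2 : ∫ z in (0 : ℝ)..x, -(|k z| * v z) ≤
        ∫ z in (0 : ℝ)..x, (p 0 * -(k z * q z * v z) + q 0 * (k z * p z * v z)) := by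
      apply intervalIntegral.integral_mono_on hx.1
      · apply Continuous.intervalIntegrable; fun_prop
      · apply Continuous.intervalIntegrable; fun_prop
      · intro z _
        have h3 : |q 0 * p z - p 0 * q z| ≤ 1 := by
          apply abs_le_one_iff_mul_self_le_one.2
          nlinarith [hpq 0, hpq z, sq_nonneg (p 0 * p z + q 0 * q z),
            congrArg₂ (· * ·) (hpq 0) (hpq z)]
        have h4 : |k z * (q 0 * p z - p 0 * q z)| ≤ |k z| := by
          rw [abs_mul]
          exact mul_le_of_le_one_right (abs_nonneg _) h3
        have h5 := mul_le_mul_of_nonneg_right (neg_le_of_abs_le h4) (hv0 z).le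
        linarith
    have h6 : ∫ z in (0 : ℝ)..x, |k z| * v z ≤ A := by
      apply intervalIntegral.integral_mono_interval le_rfl hx.1 hx.2
      · exact Filter.Eventually.of_forall fun z => mul_nonneg (abs_nonneg _) (hv0 z).le
      · apply Continuous.intervalIntegrable; fun_prop
    rw [intervalIntegral.integral_neg] at h2
    nlinarith [hpq 0]
  have h7 : ∫ x in (0 : ℝ)..T, (1 - A) * v x ≤
      ∫ x in (0 : ℝ)..T, (p 0 * (p x * v x) + q 0 * (q x * v x)) := by
    apply intervalIntegral.integral_mono_on hT.le
    · apply Continuous.intervalIntegrable; fun_prop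
    · apply Continuous.intervalIntegrable; fun_prop
    · intro x hx
      linarith [mul_le_mul_of_nonneg_right (hphi x hx) (hv0 x).le]
  rw [intervalIntegral.integral_add (by apply Continuous.intervalIntegrable; fun_prop)
    (by apply Continuous.intervalIntegrable; fun_prop), intervalIntegral.integral_const_mul,
    intervalIntegral.integral_const_mul, intervalIntegral.integral_const_mul, hp0, hq0] at h7
  have hA1 : 1 ≤ A := by
    by_contra hlt
    nlinarith [mul_pos (sub_pos.2 (not_le.1 hlt)) hL]
  have h8 := integral_mul_sq_le hT hv hv0 (f := fun _ => 1) (g := fun x => |k x|)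
    continuous_const hk.abs
  simp only [one_mul, one_pow, sq_abs] at h8
  exact (one_le_pow₀ hA1 (n := 2)).trans h8

/-! ### The geometry of a flow in coordinates -/

/-- The coordinates of the position, as functions on space-time. -/
def coord (γ : ℝ → ℝ → Plane) (i : Fin 2) (p : ℝ × ℝ) : ℝ := γ p.1 p.2 i

/-- The speed `|γₓ|`, as a function on space-time. -/
def speed (γ : ℝ → ℝ → Plane) (p : ℝ × ℝ) : ℝ :=
  √(spaceDeriv (coord γ 0) p ^ 2 + spaceDeriv (coord γ 1) p ^ 2)

/-- The coordinates of the unit tangent, as functions on space-time. -/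
def tangentCoord (γ : ℝ → ℝ → Plane) (i : Fin 2) (p : ℝ × ℝ) : ℝ :=
  (speed γ p)⁻¹ * spaceDeriv (coord γ i) p

/-- The arclength derivative `∂ₛᵃ κ` of the curvature, as a function on space-time. -/
def curv (γ : ℝ → ℝ → Plane) (a : ℕ) (p : ℝ × ℝ) : ℝ := curvatureDeriv (γ p.1) a p.2

/-- A smooth family of closed immersed curves, parametrized by time `t ≥ 0`. -/
structure IsSmoothFamily (γ : ℝ → ℝ → Plane) : Prop where
  smooth : ContDiffOn ℝ ∞ (fun p : ℝ × ℝ => γ p.1 p.2) spaceTime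
  periodic : ∀ t, 0 ≤ t → Function.Periodic (γ t) (2 * Real.pi)
  immersion : ∀ t, 0 ≤ t → ∀ x, deriv (γ t) x ≠ 0

theorem IsGradientFlow.isSmoothFamily {ε : ℝ} {γ : ℝ → ℝ → Plane} (h : IsGradientFlow ε γ) :
    IsSmoothFamily γ :=
  ⟨h.smooth, h.periodic, h.immersion⟩

theorem hasDerivAt_coord {f : ℝ → Plane} {f' : Plane} {x : ℝ} (h : HasDerivAt f f' x)
    (i : Fin 2) : HasDerivAt (fun y => f y i) (f' i) x :=
  (EuclideanSpace.proj i : Plane →L[ℝ] ℝ).hasFDerivAt.comp_hasDerivAt x h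

theorem hasDerivWithinAt_coord {f : ℝ → Plane} {f' : Plane} {s : Set ℝ} {x : ℝ}
    (h : HasDerivWithinAt f f' s x) (i : Fin 2) :
    HasDerivWithinAt (fun y => f y i) (f' i) s x :=
  (EuclideanSpace.proj i : Plane →L[ℝ] ℝ).hasFDerivAt.comp_hasDerivWithinAt
    x h

namespace IsSmoothFamily

variable {γ : ℝ → ℝ → Plane} {t : ℝ}

theorem contDiffOn_coord (h : IsSmoothFamily γ) (i : Fin 2) :
    ContDiffOn ℝ ∞ (coord γ i) spaceTime :=
  (contDiffOn_euclidean.1 h.smooth) i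

theorem deriv_apply (h : IsSmoothFamily γ) (ht : 0 ≤ t) (x : ℝ) (i : Fin 2) :
    deriv (γ t) x i = spaceDeriv (coord γ i) (t, x) := by
  have hd : DifferentiableAt ℝ (γ t) x := differentiableAt_euclidean.2 fun i =>
    (hasDerivAt_space (h.contDiffOn_coord i) ht x).differentiableAt
  exact (spaceDeriv_eq (h.contDiffOn_coord i) ht (hasDerivAt_coord hd.hasDerivAt i)).symm

theorem norm_deriv (h : IsSmoothFamily γ) (ht : 0 ≤ t) (x : ℝ) :
    ‖deriv (γ t) x‖ = speed γ (t, x) := by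
  rw [EuclideanSpace.norm_eq, Fin.sum_univ_two, h.deriv_apply ht, h.deriv_apply ht]
  simp [speed]

theorem speed_pos (h : IsSmoothFamily γ) (ht : 0 ≤ t) (x : ℝ) : 0 < speed γ (t, x) := by
  rw [← h.norm_deriv ht]
  exact norm_pos_iff.2 (h.immersion t ht x)

theorem contDiffOn_speed (h : IsSmoothFamily γ) : ContDiffOn ℝ ∞ (speed γ) spaceTime := by
  refine ContDiffOn.sqrt (((contDiffOn_spaceDeriv (h.contDiffOn_coord 0)).pow 2).add
    ((contDiffOn_spaceDeriv (h.contDiffOn_coord 1)).pow 2)) ?_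
  rintro ⟨t, x⟩ hp
  exact (Real.sqrt_pos.1 (h.speed_pos hp.1 x)).ne'

theorem contDiffOn_tangentCoord (h : IsSmoothFamily γ) (i : Fin 2) :
    ContDiffOn ℝ ∞ (tangentCoord γ i) spaceTime :=
  (h.contDiffOn_speed.inv fun p hp => (h.speed_pos hp.1 p.2).ne').mul
    (contDiffOn_spaceDeriv (h.contDiffOn_coord i))

theorem tangent_apply (h : IsSmoothFamily γ) (ht : 0 ≤ t) (x : ℝ) (i : Fin 2) :
    tangent (γ t) x i = tangentCoord γ i (t, x) := by
  simp [tangent, arcDeriv, tangentCoord, h.norm_deriv ht, h.deriv_apply ht]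

theorem speed_sq (p : ℝ × ℝ) :
    speed γ p ^ 2 = spaceDeriv (coord γ 0) p ^ 2 + spaceDeriv (coord γ 1) p ^ 2 :=
  Real.sq_sqrt (by positivity)

theorem speed_mul_tangentCoord (h : IsSmoothFamily γ) (ht : 0 ≤ t) (x : ℝ) (i : Fin 2) :
    speed γ (t, x) * tangentCoord γ i (t, x) = spaceDeriv (coord γ i) (t, x) :=
  mul_inv_cancel_left₀ (h.speed_pos ht x).ne' _

theorem tangentCoord_sq_add_sq (h : IsSmoothFamily γ) (ht : 0 ≤ t) (x : ℝ) :
    tangentCoord γ 0 (t, x) ^ 2 + tangentCoord γ 1 (t, x) ^ 2 = 1 := by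
  have h1 := speed_sq (γ := γ) (t, x)
  rw [← h.speed_mul_tangentCoord ht, ← h.speed_mul_tangentCoord ht] at h1
  have h2 := (h.speed_pos ht x).ne'
  apply mul_left_cancel₀ (pow_ne_zero 2 h2)
  linear_combination -h1

theorem curvature_eq (h : IsSmoothFamily γ) (ht : 0 ≤ t) (x : ℝ) :
    curvature (γ t) x = (speed γ (t, x))⁻¹ *
      (tangentCoord γ 0 (t, x) * spaceDeriv (tangentCoord γ 1) (t, x) -
        tangentCoord γ 1 (t, x) * spaceDeriv (tangentCoord γ 0) (t, x)) := by
  have hd : DifferentiableAt ℝ (tangent (γ t)) x := differentiableAt_euclidean.2 fun i => by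
    simp only [h.tangent_apply ht]
    exact (hasDerivAt_space (h.contDiffOn_tangentCoord i) ht x).differentiableAt
  have h1 : ∀ i, deriv (tangent (γ t)) x i = spaceDeriv (tangentCoord γ i) (t, x) := by
    intro i
    have h2 := hasDerivAt_coord hd.hasDerivAt i
    simp only [h.tangent_apply ht] at h2
    exact (spaceDeriv_eq (h.contDiffOn_tangentCoord i) ht h2).symm
  rw [curvature, PiLp.inner_apply, Fin.sum_univ_two, normal, rot, arcDeriv, h.norm_deriv ht]
  simp [h1, h.tangent_apply ht]
  ring

theorem curv_succ (h : IsSmoothFamily γ) (a : ℕ) (ht : 0 ≤ t) (x : ℝ)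
    (hs : ContDiffOn ℝ ∞ (curv γ a) spaceTime) :
    curv γ (a + 1) (t, x) = (speed γ (t, x))⁻¹ * spaceDeriv (curv γ a) (t, x) := by
  simp only [curv, curvatureDeriv, Function.iterate_succ_apply']
  rw [arcDeriv, h.norm_deriv ht, smul_eq_mul]
  congr 1
  exact (spaceDeriv_eq hs ht (hasDerivAt_space hs ht x).differentiableAt.hasDerivAt).symm

theorem contDiffOn_curv (h : IsSmoothFamily γ) (a : ℕ) :
    ContDiffOn ℝ ∞ (curv γ a) spaceTime := by
  have hinv : ContDiffOn ℝ ∞ (fun p => (speed γ p)⁻¹) spaceTime :=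
    h.contDiffOn_speed.inv fun p hp => (h.speed_pos hp.1 p.2).ne'
  induction a with
  | zero =>
    have h0 := h.contDiffOn_tangentCoord 0
    have h1 := h.contDiffOn_tangentCoord 1
    exact (hinv.mul ((h0.mul (contDiffOn_spaceDeriv h1)).sub
      (h1.mul (contDiffOn_spaceDeriv h0)))).congr fun p hp => h.curvature_eq hp.1 p.2
  | succ a ih =>
    exact (hinv.mul (contDiffOn_spaceDeriv ih)).congr fun p hp => h.curv_succ a hp.1 p.2 ih

theorem hasDerivAt_curv (h : IsSmoothFamily γ) (a : ℕ) (ht : 0 ≤ t) (x : ℝ) :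
    HasDerivAt (fun y => curv γ a (t, y)) (curv γ (a + 1) (t, x) * speed γ (t, x)) x := by
  refine (hasDerivAt_space (h.contDiffOn_curv a) ht x).congr_deriv ?_
  rw [h.curv_succ a ht x (h.contDiffOn_curv a), mul_comm,
    mul_inv_cancel_left₀ (h.speed_pos ht x).ne']

/-- The Frenet equations `∂ₛ τ = κ ν` in coordinates. -/
theorem spaceDeriv_tangentCoord (h : IsSmoothFamily γ) (ht : 0 ≤ t) (x : ℝ) :
    spaceDeriv (tangentCoord γ 0) (t, x) =
        -(curv γ 0 (t, x) * tangentCoord γ 1 (t, x) * speed γ (t, x)) ∧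
      spaceDeriv (tangentCoord γ 1) (t, x) =
        curv γ 0 (t, x) * tangentCoord γ 0 (t, x) * speed γ (t, x) := by
  have h0 := hasDerivAt_space (h.contDiffOn_tangentCoord 0) ht x
  have h1 := hasDerivAt_space (h.contDiffOn_tangentCoord 1) ht x
  have h2 := (h0.fun_pow 2).add (h1.fun_pow 2)
  have h3 : ((fun y => tangentCoord γ 0 (t, y) ^ 2) + fun y => tangentCoord γ 1 (t, y) ^ 2) =
      fun _ => (1 : ℝ) := funext fun y => h.tangentCoord_sq_add_sq ht y
  rw [h3] at h2
  have h4 := h2.unique (hasDerivAt_const x (1 : ℝ))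
  have h5 : curv γ 0 (t, x) * speed γ (t, x) =
      tangentCoord γ 0 (t, x) * spaceDeriv (tangentCoord γ 1) (t, x) -
        tangentCoord γ 1 (t, x) * spaceDeriv (tangentCoord γ 0) (t, x) := by
    have := h.curvature_eq ht x
    rw [show curv γ 0 (t, x) = curvature (γ t) x from rfl, this, mul_comm,
      mul_inv_cancel_left₀ (h.speed_pos ht x).ne']
  have h6 := h.tangentCoord_sq_add_sq ht x
  norm_num at h4
  constructor
  · linear_combination tangentCoord γ 1 (t, x) * h5 + tangentCoord γ 0 (t, x) * h4 / 2 -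
      spaceDeriv (tangentCoord γ 0) (t, x) * h6
  · linear_combination (-tangentCoord γ 0 (t, x)) * h5 + tangentCoord γ 1 (t, x) * h4 / 2 -
      spaceDeriv (tangentCoord γ 1) (t, x) * h6

theorem periodic_curvatureDeriv (h : IsSmoothFamily γ) (ht : 0 ≤ t) (a : ℕ) :
    Function.Periodic (curvatureDeriv (γ t) a) (2 * Real.pi) := by
  have hder : ∀ {F : Type} [NormedAddCommGroup F] [NormedSpace ℝ F] {f : ℝ → F},
      Function.Periodic f (2 * Real.pi) → Function.Periodic (deriv f) (2 * Real.pi) := by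
    intro F _ _ f hf x
    rw [← deriv_comp_add_const]
    exact congrArg (deriv · x) (funext hf)
  have harc : ∀ {F : Type} [NormedAddCommGroup F] [NormedSpace ℝ F] {f : ℝ → F},
      Function.Periodic f (2 * Real.pi) →
        Function.Periodic (arcDeriv (γ t) f) (2 * Real.pi) := by
    intro F _ _ f hf x
    simp only [arcDeriv, hder (h.periodic t ht) x, hder hf x]
  have htan : Function.Periodic (tangent (γ t)) (2 * Real.pi) := harc (h.periodic t ht)
  induction a with
  | zero =>
    intro x
    simp only [curvatureDeriv, Function.iterate_zero, id, curvature, normal]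
    rw [harc htan x, htan x]
  | succ a ih =>
    simp only [curvatureDeriv, Function.iterate_succ_apply'] at ih ⊢
    exact harc ih

theorem isPeriodicJet (h : IsSmoothFamily γ) (ht : 0 ≤ t) :
    IsPeriodicJet (2 * Real.pi) (fun x => speed γ (t, x)) fun a x => curv γ a (t, x) where
  pos := by positivity
  cont := continuous_slice h.contDiffOn_speed.continuousOn ht
  speed_pos := h.speed_pos ht
  hasDerivAt a x := h.hasDerivAt_curv a ht x
  endpoints a := by simpa [curv] using h.periodic_curvatureDeriv ht a 0

theorem one_le_length_mul_energy (h : IsSmoothFamily γ) (ht : 0 ≤ t) :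
    1 ≤ (∫ x in (0 : ℝ)..2 * Real.pi, speed γ (t, x)) *
      ∫ x in (0 : ℝ)..2 * Real.pi, curv γ 0 (t, x) ^ 2 * speed γ (t, x) := by
  have hmean : ∀ i, ∫ x in (0 : ℝ)..2 * Real.pi, tangentCoord γ i (t, x) * speed γ (t, x) = 0 := by
    intro i
    simp only [mul_comm _ (speed γ _), h.speed_mul_tangentCoord ht]
    rw [intervalIntegral.integral_eq_sub_of_hasDerivAt
      (fun x _ => hasDerivAt_space (h.contDiffOn_coord i) ht x)
      ((continuous_slice (contDiffOn_spaceDeriv (h.contDiffOn_coord i)).continuousOn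
        ht).intervalIntegrable _ _)]
    have := h.periodic t ht 0
    rw [zero_add] at this
    simp [coord, this]
  refine one_le_length_mul_integral_sq (by positivity)
    (continuous_slice h.contDiffOn_speed.continuousOn ht) (h.speed_pos ht)
    (continuous_slice (h.contDiffOn_curv 0).continuousOn ht) (fun x => ?_) (fun x => ?_)
    (h.tangentCoord_sq_add_sq ht) (hmean 0) (hmean 1)
  · exact (hasDerivAt_space (h.contDiffOn_tangentCoord 0) ht x).congr_deriv
      (h.spaceDeriv_tangentCoord ht x).1
  · exact (hasDerivAt_space (h.contDiffOn_tangentCoord 1) ht x).congr_deriv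
      (h.spaceDeriv_tangentCoord ht x).2

end IsSmoothFamily

/-! ### Evolution equations -/

/-- The normal velocity `κ - 2 ε ∂ₛ² κ - ε κ³` of the flow, as a function on space-time. -/
def normalVelocity (ε : ℝ) (γ : ℝ → ℝ → Plane) (p : ℝ × ℝ) : ℝ :=
  curv γ 0 p - 2 * ε * curv γ 2 p - ε * curv γ 0 p ^ 3

namespace IsGradientFlow

variable {ε : ℝ} {γ : ℝ → ℝ → Plane} {t : ℝ}

theorem timeDeriv_coord (h : IsGradientFlow ε γ) (ht : 0 ≤ t) (x : ℝ) :
    timeDeriv (coord γ 0) (t, x) = -(normalVelocity ε γ (t, x) * tangentCoord γ 1 (t, x)) ∧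
      timeDeriv (coord γ 1) (t, x) = normalVelocity ε γ (t, x) * tangentCoord γ 0 (t, x) := by
  have hs := h.isSmoothFamily
  have hd : DifferentiableWithinAt ℝ (fun s => γ s x) (Set.Ici 0) t :=
    differentiableWithinAt_euclidean.2 fun i =>
      (hasDerivWithinAt_time (hs.contDiffOn_coord i) ht x).differentiableWithinAt
  have h1 := fun i => timeDeriv_eq (hs.contDiffOn_coord i) ht
    (hasDerivWithinAt_coord hd.hasDerivWithinAt i)
  rw [h1, h1, h.evolution t ht x]
  have hE : energyGradient ε (γ t) x = -normalVelocity ε γ (t, x) := by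
    simp [energyGradient, normalVelocity, curv, curvatureDeriv]
    ring
  simp [hE, normal, rot, hs.tangent_apply ht]

/-- The arclength derivative of the normal velocity. -/
def normalVelocityDeriv (ε : ℝ) (γ : ℝ → ℝ → Plane) (p : ℝ × ℝ) : ℝ :=
  curv γ 1 p - 2 * ε * curv γ 3 p - 3 * ε * curv γ 0 p ^ 2 * curv γ 1 p

theorem hasDerivAt_normalVelocity (h : IsGradientFlow ε γ) (ht : 0 ≤ t) (x : ℝ) :
    HasDerivAt (fun y => normalVelocity ε γ (t, y))
      (normalVelocityDeriv ε γ (t, x) * speed γ (t, x)) x := by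
  have hk := fun a => h.isSmoothFamily.hasDerivAt_curv a ht x
  refine (((hk 0).sub ((hk 2).const_mul (2 * ε))).sub
    (((hk 0).fun_pow 3).const_mul ε)).congr_deriv ?_
  simp only [normalVelocityDeriv]
  ring

theorem hasDerivAt_normalVelocityDeriv (h : IsGradientFlow ε γ) (ht : 0 ≤ t) (x : ℝ) :
    HasDerivAt (fun y => normalVelocityDeriv ε γ (t, y))
      ((curv γ 2 (t, x) - 2 * ε * curv γ 4 (t, x) - 6 * ε * curv γ 0 (t, x) * curv γ 1 (t, x) ^ 2 -
        3 * ε * curv γ 0 (t, x) ^ 2 * curv γ 2 (t, x)) * speed γ (t, x)) x := by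
  have hk := fun a => h.isSmoothFamily.hasDerivAt_curv a ht x
  refine (((hk 1).sub ((hk 3).const_mul (2 * ε))).sub
    ((((hk 0).fun_pow 2).const_mul (3 * ε)).mul (hk 1))).congr_deriv ?_
  ring

/-- Time derivative of `γₓ`, by commuting derivatives. -/
theorem timeDeriv_spaceDeriv_coord (h : IsGradientFlow ε γ) (ht : 0 ≤ t) (x : ℝ) :
    timeDeriv (spaceDeriv (coord γ 0)) (t, x) =
        -(normalVelocityDeriv ε γ (t, x) * tangentCoord γ 1 (t, x) +
          normalVelocity ε γ (t, x) * curv γ 0 (t, x) * tangentCoord γ 0 (t, x)) *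
          speed γ (t, x) ∧
      timeDeriv (spaceDeriv (coord γ 1)) (t, x) =
        (normalVelocityDeriv ε γ (t, x) * tangentCoord γ 0 (t, x) -
          normalVelocity ε γ (t, x) * curv γ 0 (t, x) * tangentCoord γ 1 (t, x)) *
          speed γ (t, x) := by
  have hs := h.isSmoothFamily
  have hF := h.hasDerivAt_normalVelocity ht x
  have h0 := hasDerivAt_space (hs.contDiffOn_tangentCoord 0) ht x
  have h1 := hasDerivAt_space (hs.contDiffOn_tangentCoord 1) ht x
  rw [(hs.spaceDeriv_tangentCoord ht x).1] at h0
  rw [(hs.spaceDeriv_tangentCoord ht x).2] at h1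
  rw [timeDeriv_spaceDeriv (hs.contDiffOn_coord 0) ht,
    timeDeriv_spaceDeriv (hs.contDiffOn_coord 1) ht]
  constructor
  · apply spaceDeriv_eq (contDiffOn_timeDeriv (hs.contDiffOn_coord 0)) ht
    simp only [(h.timeDeriv_coord ht _).1]
    exact (hF.mul h1).neg.congr_deriv (by ring)
  · apply spaceDeriv_eq (contDiffOn_timeDeriv (hs.contDiffOn_coord 1)) ht
    simp only [(h.timeDeriv_coord ht _).2]
    exact (hF.mul h0).congr_deriv (by ring)

/-- The length element evolves by `∂ₜ |γₓ| = -κ F |γₓ|`. -/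
theorem timeDeriv_speed (h : IsGradientFlow ε γ) (ht : 0 ≤ t) (x : ℝ) :
    timeDeriv (speed γ) (t, x) =
      -(normalVelocity ε γ (t, x) * curv γ 0 (t, x) * speed γ (t, x)) := by
  have hs := h.isSmoothFamily
  have hv := hasDerivWithinAt_time hs.contDiffOn_speed ht x
  have h0 := hasDerivWithinAt_time (contDiffOn_spaceDeriv (hs.contDiffOn_coord 0)) ht x
  have h1 := hasDerivWithinAt_time (contDiffOn_spaceDeriv (hs.contDiffOn_coord 1)) ht x
  have h2 := (h0.fun_pow 2).fun_add (h1.fun_pow 2)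
  simp only [← IsSmoothFamily.speed_sq] at h2
  have h3 := (uniqueDiffOn_Ici 0 t ht).eq_deriv _ (hv.fun_pow 2) h2
  rw [(h.timeDeriv_spaceDeriv_coord ht x).1, (h.timeDeriv_spaceDeriv_coord ht x).2,
    ← hs.speed_mul_tangentCoord ht, ← hs.speed_mul_tangentCoord ht] at h3
  have h4 := hs.tangentCoord_sq_add_sq ht x
  norm_num at h3
  apply mul_left_cancel₀ (hs.speed_pos ht x).ne'
  linear_combination h3 / 2 -
    normalVelocity ε γ (t, x) * curv γ 0 (t, x) * speed γ (t, x) ^ 2 * h4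

/-- The unit tangent evolves by `∂ₜ τ = (∂ₛ F) ν`. -/
theorem timeDeriv_tangentCoord (h : IsGradientFlow ε γ) (ht : 0 ≤ t) (x : ℝ) :
    timeDeriv (tangentCoord γ 0) (t, x) =
        -(normalVelocityDeriv ε γ (t, x) * tangentCoord γ 1 (t, x)) ∧
      timeDeriv (tangentCoord γ 1) (t, x) =
        normalVelocityDeriv ε γ (t, x) * tangentCoord γ 0 (t, x) := by
  have hs := h.isSmoothFamily
  have key : ∀ i, timeDeriv (speed γ) (t, x) * tangentCoord γ i (t, x) +
      speed γ (t, x) * timeDeriv (tangentCoord γ i) (t, x) =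
        timeDeriv (spaceDeriv (coord γ i)) (t, x) := by
    intro i
    refine (uniqueDiffOn_Ici 0 t ht).eq_deriv _
      ((hasDerivWithinAt_time hs.contDiffOn_speed ht x).mul
        (hasDerivWithinAt_time (hs.contDiffOn_tangentCoord i) ht x))
      ((hasDerivWithinAt_time (contDiffOn_spaceDeriv (hs.contDiffOn_coord i)) ht x).congr
        (fun s hs' => hs.speed_mul_tangentCoord hs' x i) (hs.speed_mul_tangentCoord ht x i))
  have h0 := key 0
  have h1 := key 1
  rw [h.timeDeriv_speed ht, (h.timeDeriv_spaceDeriv_coord ht x).1] at h0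
  rw [h.timeDeriv_speed ht, (h.timeDeriv_spaceDeriv_coord ht x).2] at h1
  constructor
  · apply mul_left_cancel₀ (hs.speed_pos ht x).ne'
    linear_combination h0
  · apply mul_left_cancel₀ (hs.speed_pos ht x).ne'
    linear_combination h1

/-- The curvature evolves by `∂ₜ κ = ∂ₛ² F + κ² F`. -/
theorem timeDeriv_curv_zero (h : IsGradientFlow ε γ) (ht : 0 ≤ t) (x : ℝ) :
    timeDeriv (curv γ 0) (t, x) =
      curv γ 2 (t, x) - 2 * ε * curv γ 4 (t, x) + curv γ 0 (t, x) ^ 3 -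
        ε * (6 * curv γ 0 (t, x) * curv γ 1 (t, x) ^ 2 +
          5 * curv γ 0 (t, x) ^ 2 * curv γ 2 (t, x) + curv γ 0 (t, x) ^ 5) := by
  have hs := h.isSmoothFamily
  have hv := hasDerivWithinAt_time hs.contDiffOn_speed ht x
  have hk := hasDerivWithinAt_time (hs.contDiffOn_curv 0) ht x
  have h0 := hasDerivWithinAt_time (hs.contDiffOn_tangentCoord 0) ht x
  have h1 := hasDerivWithinAt_time (hs.contDiffOn_tangentCoord 1) ht x
  have hFs := h.hasDerivAt_normalVelocityDeriv ht x
  have hx0 := hasDerivAt_space (hs.contDiffOn_tangentCoord 0) ht x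
  have hx1 := hasDerivAt_space (hs.contDiffOn_tangentCoord 1) ht x
  -- both sides of the Frenet equations are differentiated in time
  have e0 : timeDeriv (spaceDeriv (tangentCoord γ 0)) (t, x) = _ :=
    (uniqueDiffOn_Ici 0 t ht).eq_deriv _
      (hasDerivWithinAt_time (contDiffOn_spaceDeriv (hs.contDiffOn_tangentCoord 0)) ht x)
      (((hk.fun_mul h1).fun_mul hv).fun_neg.congr
        (fun s hs' => (hs.spaceDeriv_tangentCoord hs' x).1) (hs.spaceDeriv_tangentCoord ht x).1)
  have e1 : timeDeriv (spaceDeriv (tangentCoord γ 1)) (t, x) = _ :=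
    (uniqueDiffOn_Ici 0 t ht).eq_deriv _
      (hasDerivWithinAt_time (contDiffOn_spaceDeriv (hs.contDiffOn_tangentCoord 1)) ht x)
      (((hk.fun_mul h0).fun_mul hv).congr
        (fun s hs' => (hs.spaceDeriv_tangentCoord hs' x).2) (hs.spaceDeriv_tangentCoord ht x).2)
  have f0 := spaceDeriv_eq (contDiffOn_timeDeriv (hs.contDiffOn_tangentCoord 0)) ht
    ((hFs.fun_mul hx1).fun_neg.congr_of_eventuallyEq
      (Filter.Eventually.of_forall fun y => (h.timeDeriv_tangentCoord ht y).1))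
  have f1 := spaceDeriv_eq (contDiffOn_timeDeriv (hs.contDiffOn_tangentCoord 1)) ht
    ((hFs.fun_mul hx0).congr_of_eventuallyEq
      (Filter.Eventually.of_forall fun y => (h.timeDeriv_tangentCoord ht y).2))
  rw [timeDeriv_spaceDeriv (hs.contDiffOn_tangentCoord 0) ht, f0,
    (hs.spaceDeriv_tangentCoord ht x).2, (h.timeDeriv_tangentCoord ht x).2,
    h.timeDeriv_speed ht] at e0
  rw [timeDeriv_spaceDeriv (hs.contDiffOn_tangentCoord 1) ht, f1,
    (hs.spaceDeriv_tangentCoord ht x).1, (h.timeDeriv_tangentCoord ht x).1,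
    h.timeDeriv_speed ht] at e1
  have h4 := hs.tangentCoord_sq_add_sq ht x
  simp only [normalVelocity] at e0 e1
  apply mul_left_cancel₀ (hs.speed_pos ht x).ne'
  linear_combination tangentCoord γ 1 (t, x) * e0 - tangentCoord γ 0 (t, x) * e1 -
    speed γ (t, x) * (timeDeriv (curv γ 0) (t, x) -
      (curv γ 2 (t, x) - 2 * ε * curv γ 4 (t, x) + curv γ 0 (t, x) ^ 3 -
        ε * (6 * curv γ 0 (t, x) * curv γ 1 (t, x) ^ 2 +
          5 * curv γ 0 (t, x) ^ 2 * curv γ 2 (t, x) + curv γ 0 (t, x) ^ 5))) * h4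

end IsGradientFlow

/-- The evolution of the arclength derivatives of the curvature.  The commutator of `∂ₜ` and `∂ₛ`
is `κ F ∂ₛ`, so that, apart from the leading linear terms, only
products of at least three factors appear; their total order and weight are what scaling
predicts. -/
theorem exists_timeDeriv_curv (j : ℕ) : ∃ P Q : (ℕ → ℝ) → ℝ,
    IsDiffPoly j (2 * j + 3) P ∧ IsDiffPoly (j + 2) (2 * j + 7) Q ∧
    ∀ (ε : ℝ) (γ : ℝ → ℝ → Plane), IsGradientFlow ε γ → ∀ t : ℝ, 0 ≤ t → ∀ x : ℝ,
      timeDeriv (curv γ j) (t, x) = curv γ (j + 2) (t, x) - 2 * ε * curv γ (j + 4) (t, x) +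
        (P fun a => curv γ a (t, x)) + ε * Q fun a => curv γ a (t, x) := by
  induction j with
  | zero =>
    refine ⟨fun u => u 0 * u 0 * u 0, fun u => -6 * (u 0 * (u 1 * u 1)) +
        (-5 * (u 0 * u 0 * u 2) + -1 * (u 0 * u 0 * u 0 * u 0 * u 0)), ?_, ?_,
      fun ε γ h t ht x => ?_⟩
    · exact ((IsDiffPoly.var 0).mul (.var 0)).mul (.var 0)
    · refine .add (.smul _ ?_) (.add (.smul _ ?_) (.smul _ ?_))
      · exact (IsDiffPoly.var 0).mul ((IsDiffPoly.var 1).mul (.var 1))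
      · exact ((IsDiffPoly.var 0).mul (.var 0)).mul (.var 2)
      · exact ((((((IsDiffPoly.var 0).mul (.var 0)).mul (.var 0)).mul (.var 0)).mul
          (.var 0))).mono (by omega) (by omega)
    · rw [h.timeDeriv_curv_zero ht]
      ring
  | succ j ih =>
    obtain ⟨P, Q, hP, hQ, hPQ⟩ := ih
    obtain ⟨P', hP', hdP⟩ := hP.exists_deriv
    obtain ⟨Q', hQ', hdQ⟩ := hQ.exists_deriv
    refine ⟨fun u => P' u + u (j + 1) * (u 0 * u 0),
      fun u => Q' u + (-2 * (u (j + 1) * (u 0 * u 2)) +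
        -1 * (u (j + 1) * (u 0 * u 0 * u 0 * u 0))), ?_, ?_, fun ε γ h t ht x => ?_⟩
    · exact .add (hP'.mono (by omega) (by omega))
        (((IsDiffPoly.var (j + 1)).mul ((IsDiffPoly.var 0).mul (.var 0))).mono
          (by omega) (by omega))
    · refine .add (hQ'.mono (by omega) (by omega)) (.add (.smul _ ?_) (.smul _ ?_))
      · exact ((IsDiffPoly.var (j + 1)).mul ((IsDiffPoly.var 0).mul (.var 2))).mono
          (by omega) (by omega)
      · exact ((IsDiffPoly.var (j + 1)).mul ((((IsDiffPoly.var 0).mul (.var 0)).mul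
          (.var 0)).mul (.var 0))).mono (by omega) (by omega)
    · have hs := h.isSmoothFamily
      have hk := fun a => hs.hasDerivAt_curv a ht x
      have hspace : ∀ s, 0 ≤ s → curv γ (j + 1) (s, x) * speed γ (s, x) =
          spaceDeriv (curv γ j) (s, x) := fun s hs' =>
        (spaceDeriv_eq (hs.contDiffOn_curv j) hs' (hs.hasDerivAt_curv j hs' x)).symm
      have h1 := (uniqueDiffOn_Ici 0 t ht).eq_deriv _
        ((hasDerivWithinAt_time (hs.contDiffOn_curv (j + 1)) ht x).fun_mul
          (hasDerivWithinAt_time hs.contDiffOn_speed ht x))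
        ((hasDerivWithinAt_time (contDiffOn_spaceDeriv (hs.contDiffOn_curv j)) ht x).congr
          (fun s hs' => hspace s hs') (hspace t ht))
      have h2 := spaceDeriv_eq (contDiffOn_timeDeriv (hs.contDiffOn_curv j)) ht
        (((((hk (j + 2)).fun_sub ((hk (j + 4)).const_mul (2 * ε))).fun_add
          (hdP (fun y => speed γ (t, y)) _ x hk)).fun_add
          ((hdQ (fun y => speed γ (t, y)) _ x hk).const_mul ε)).congr_of_eventuallyEq
          (Filter.Eventually.of_forall fun y => hPQ ε γ h t ht y))
      rw [timeDeriv_spaceDeriv (hs.contDiffOn_curv j) ht, h2, h.timeDeriv_speed ht] at h1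
      simp only [normalVelocity] at h1
      apply mul_left_cancel₀ (hs.speed_pos ht x).ne'
      rw [show j + 1 + 2 = j + 2 + 1 by ring, show j + 1 + 4 = j + 4 + 1 by ring]
      linear_combination h1

/-! ### The energy estimate -/

/-- The time derivative of `∫ |∂ₛʲ κ|² ds`: the leading terms have a sign after integration by
parts, and the remaining terms are differential polynomials. -/
theorem exists_hasDerivWithinAt_energy (j : ℕ) : ∃ P Q : (ℕ → ℝ) → ℝ,
    IsDiffPoly j (2 * j + 3) P ∧ IsDiffPoly (j + 2) (2 * j + 7) Q ∧
    ∀ (ε : ℝ) (γ : ℝ → ℝ → Plane), IsGradientFlow ε γ → ∀ t : ℝ, 0 ≤ t →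
      HasDerivWithinAt
        (fun s => ∫ x in (0 : ℝ)..2 * Real.pi, curv γ j (s, x) ^ 2 * speed γ (s, x))
        (-2 * (∫ x in (0 : ℝ)..2 * Real.pi, curv γ (j + 1) (t, x) ^ 2 * speed γ (t, x)) -
          4 * ε * (∫ x in (0 : ℝ)..2 * Real.pi, curv γ (j + 2) (t, x) ^ 2 * speed γ (t, x)) +
          (∫ x in (0 : ℝ)..2 * Real.pi,
            curv γ j (t, x) * (P fun a => curv γ a (t, x)) * speed γ (t, x)) +
          ε * ∫ x in (0 : ℝ)..2 * Real.pi,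
            curv γ j (t, x) * (Q fun a => curv γ a (t, x)) * speed γ (t, x))
        (Set.Ici 0) t := by
  obtain ⟨P, Q, hP, hQ, hPQ⟩ := exists_timeDeriv_curv j
  have hP1 : IsDiffPoly j (2 * j + 3) fun u => 2 * P u + -1 * (u j * (u 0 * u 0)) :=
    .add (.smul _ hP) (.smul _ (((IsDiffPoly.var j).mul ((IsDiffPoly.var 0).mul (.var 0))).mono
      (by omega) (by omega)))
  have hQ1 : IsDiffPoly (j + 2) (2 * j + 7) fun u => 2 * Q u +
      (2 * (u j * (u 0 * u 2)) + u j * (u 0 * u 0 * u 0 * u 0)) :=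
    .add (.smul _ hQ) (.add
      (.smul _ (((IsDiffPoly.var j).mul ((IsDiffPoly.var 0).mul (.var 2))).mono
        (by omega) (by omega)))
      (((IsDiffPoly.var j).mul ((((IsDiffPoly.var 0).mul (.var 0)).mul
          (.var 0)).mul (.var 0))).mono (by omega) (by omega)))
  refine ⟨_, _, hP1, hQ1, fun ε γ h t ht => ?_⟩
  have hs := h.isSmoothFamily
  have hjet := hs.isPeriodicJet ht
  have hsm : ContDiffOn ℝ ∞ (fun p => curv γ j p ^ 2 * speed γ p) spaceTime :=
    ((hs.contDiffOn_curv j).pow 2).mul hs.contDiffOn_speed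
  refine (hasDerivWithinAt_integral hsm ht).congr_deriv ?_
  have hpt : ∀ x, timeDeriv (fun p => curv γ j p ^ 2 * speed γ p) (t, x) =
      2 * (curv γ j (t, x) * curv γ (j + 2) (t, x) * speed γ (t, x)) +
      -(4 * ε) * (curv γ j (t, x) * curv γ (j + 4) (t, x) * speed γ (t, x)) +
      curv γ j (t, x) * ((fun u : ℕ → ℝ => 2 * P u + -1 * (u j * (u 0 * u 0)))
        fun a => curv γ a (t, x)) * speed γ (t, x) +
      ε * (curv γ j (t, x) * ((fun u : ℕ → ℝ => 2 * Q u +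
        (2 * (u j * (u 0 * u 2)) + u j * (u 0 * u 0 * u 0 * u 0)))
        fun a => curv γ a (t, x)) * speed γ (t, x)) := by
    intro x
    rw [timeDeriv_eq hsm ht (((hasDerivWithinAt_time (hs.contDiffOn_curv j) ht x).fun_pow 2).fun_mul
      (hasDerivWithinAt_time hs.contDiffOn_speed ht x)), hPQ ε γ h t ht x, h.timeDeriv_speed ht]
    simp only [normalVelocity]
    ring
  have hlin : ∀ f₁ f₂ f₃ f₄ : ℝ → ℝ, Continuous f₁ → Continuous f₂ → Continuous f₃ →
      Continuous f₄ → ∫ x in (0 : ℝ)..2 * Real.pi,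
        (2 * f₁ x + -(4 * ε) * f₂ x + f₃ x + ε * f₄ x) =
      2 * (∫ x in (0 : ℝ)..2 * Real.pi, f₁ x) + -(4 * ε) * (∫ x in (0 : ℝ)..2 * Real.pi, f₂ x) +
        (∫ x in (0 : ℝ)..2 * Real.pi, f₃ x) + ε * ∫ x in (0 : ℝ)..2 * Real.pi, f₄ x := by
    intro f₁ f₂ f₃ f₄ c₁ c₂ c₃ c₄
    rw [intervalIntegral.integral_add, intervalIntegral.integral_add,
      intervalIntegral.integral_add, intervalIntegral.integral_const_mul,
      intervalIntegral.integral_const_mul, intervalIntegral.integral_const_mul]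
    all_goals apply Continuous.intervalIntegrable; fun_prop
  have hc := hjet.continuous
  have hv := hjet.cont
  refine (intervalIntegral.integral_congr fun x _ => hpt x).trans ((hlin _ _ _ _
    (((hc j).fun_mul (hc (j + 2))).fun_mul hv) (((hc j).fun_mul (hc (j + 4))).fun_mul hv)
    (((hc j).fun_mul (hP1.continuous hc)).fun_mul hv)
    (((hc j).fun_mul (hQ1.continuous hc)).fun_mul hv)).trans ?_)
  rw [hjet.integral_mul_deriv j (j + 1), hjet.integral_mul_deriv j (j + 3),
    hjet.integral_mul_deriv (j + 1) (j + 2)]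
  simp only [sq]
  ring

end

end PlaneCurve

theorem theorem3p9 (j : ℕ) :
    ∃ Z : ℝ → ℝ, ContDiff ℝ ∞ Z ∧ (∀ y : ℝ, 0 < Z y) ∧
      ∀ (ε : ℝ), 0 < ε → ε < 1 → ∀ (γ : ℝ → ℝ → Plane), PlaneCurve.IsGradientFlow ε γ →
        ∀ t : ℝ, 0 ≤ t →
          DifferentiableWithinAt ℝ
            (fun s => PlaneCurve.arcIntegral (γ s)
              (fun x => PlaneCurve.curvatureDeriv (γ s) j x ^ 2)) (Set.Ici 0) t ∧
          derivWithin
            (fun s => PlaneCurve.arcIntegral (γ s)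
              (fun x => PlaneCurve.curvatureDeriv (γ s) j x ^ 2)) (Set.Ici 0) t ≤
            Z (PlaneCurve.arcIntegral (γ t)
              (fun x => PlaneCurve.curvature (γ t) x ^ 2)) := by
  obtain ⟨P, Q, hP, hQ, hPQ⟩ := PlaneCurve.exists_hasDerivWithinAt_energy j
  -- the second-order part controls `P` through order `j + 1`, the fourth-order part controls `Q`
  -- through order `j + 2`
  obtain ⟨K, hK⟩ := hP.exists_integral_mul_le (j := j) (m := j + 1) (by omega) (by omega)
    (by omega) (by omega)
  obtain ⟨K', hK'⟩ := hQ.exists_integral_mul_le (j := j) (m := j + 2) (by omega) (by omega)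
    (by omega) (by omega)
  refine ⟨fun y => (3 + y ^ 2) ^ K + (3 + y ^ 2) ^ K', by fun_prop, fun y => by positivity,
    fun ε hε hε1 γ h t ht => ?_⟩
  have hs := h.isSmoothFamily
  have harc : ∀ s, 0 ≤ s → ∀ a, PlaneCurve.arcIntegral (γ s)
      (fun x => PlaneCurve.curvatureDeriv (γ s) a x ^ 2) =
      ∫ x in (0 : ℝ)..2 * Real.pi, PlaneCurve.curv γ a (s, x) ^ 2 * PlaneCurve.speed γ (s, x) := by
    intro s hs' a
    simp only [PlaneCurve.arcIntegral, hs.norm_deriv hs', PlaneCurve.curv]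
  have hder := (hPQ ε γ h t ht).congr (fun s hs' => harc s hs' j) (harc t ht j)
  refine ⟨hder.differentiableWithinAt, ?_⟩
  rw [hder.derivWithin (uniqueDiffOn_Ici 0 t ht)]
  have h0 : PlaneCurve.arcIntegral (γ t) (fun x => PlaneCurve.curvature (γ t) x ^ 2) = _ :=
    harc t ht 0
  rw [h0]
  have hjet := hs.isPeriodicJet ht
  have hL := hs.one_le_length_mul_energy ht
  have hb : 2 + (∫ x in (0 : ℝ)..2 * Real.pi,
      PlaneCurve.curv γ 0 (t, x) ^ 2 * PlaneCurve.speed γ (t, x)) ≤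
      3 + (∫ x in (0 : ℝ)..2 * Real.pi,
        PlaneCurve.curv γ 0 (t, x) ^ 2 * PlaneCurve.speed γ (t, x)) ^ 2 := by
    nlinarith [sq_nonneg ((∫ x in (0 : ℝ)..2 * Real.pi,
      PlaneCurve.curv γ 0 (t, x) ^ 2 * PlaneCurve.speed γ (t, x)) - 1)]
  have h1 := hK _ _ _ _ hjet hL hb
  have h2 := hK' _ _ _ _ hjet hL hb
  have h3 := hjet.integral_sq_nonneg (j + 1)
  have h4 := hjet.integral_sq_nonneg (j + 2)
  have h5 := mul_le_mul_of_nonneg_left h2 hε.le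
  have h6 := mul_nonneg hε.le h4
  have h7 : 0 ≤ (3 + (∫ x in (0 : ℝ)..2 * Real.pi,
      PlaneCurve.curv γ 0 (t, x) ^ 2 * PlaneCurve.speed γ (t, x)) ^ 2) ^ K' := by positivity
  have h8 := mul_le_of_le_one_left h7 hε1.le
  linarith
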